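/- For $n\ge 1$ let $\mathcal G_n$ denote the $2$-by-$n$ square grid graph. Let $T_n$ be the number of spanning trees of $\mathcal G_n$, and let $S_n$ be the number of balanced spanning trees of $\mathcal G_n$, that is, spanning trees containing an edge whose removal partitions the $2n$ vertices into two connected components with the same number of vertices. Then: 1. (Odd case) $\displaystyle\lim_{m\to\infty}\frac{S_{2m+1}}{T_{2m+1}}=\frac{3+\sqrt3}{9}\approx 0.53$. 2. (Even case) $\displaystyle\lim_{m\to\infty}\frac{S_{2m}}{T_{2m}}=\frac{1+4\sqrt3}{6\sqrt3}\approx 0.76$. (The decimal approximations are rounded to two digits.) -/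

import Mathlib

namespace BalancedTrees

open SimpleGraph

/-- The `2`-by-`n` square grid graph. -/
abbrev grid (n : ℕ) : SimpleGraph (Fin 2 × Fin n) := pathGraph 2 □ pathGraph n

/-- The spanning trees of a graph `G`: trees on the whole vertex set of `G`
all of whose edges are edges of `G`. -/
def spanningTrees {V : Type*} (G : SimpleGraph V) : Set (SimpleGraph V) :=
  {H | H ≤ G ∧ H.IsTree}

/-- `e` is a balanced cut edge of `H`: it is an edge of `H`, and its removal leaves exactly
two connected components, with equally many vertices. -/
def IsBalancedCutEdge {V : Type*} (H : SimpleGraph V) (e : Sym2 V) : Prop :=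
  e ∈ H.edgeSet ∧ ∃ C D : (H.deleteEdges {e}).ConnectedComponent,
    C ≠ D ∧ (∀ K, K = C ∨ K = D) ∧ C.supp.ncard = D.supp.ncard

/-- The balanced spanning trees of a graph: those with a balanced cut edge. -/
def balancedSpanningTrees {V : Type*} (G : SimpleGraph V) : Set (SimpleGraph V) :=
  {H | H ∈ spanningTrees G ∧ ∃ e, IsBalancedCutEdge H e}

/-- The number of spanning trees of the `2`-by-`n` grid. -/
noncomputable def T (n : ℕ) : ℕ := (spanningTrees (grid n)).ncard

/-- The number of balanced spanning trees of the `2`-by-`n` grid. -/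
noncomputable def S (n : ℕ) : ℕ := (balancedSpanningTrees (grid n)).ncard

end BalancedTrees

/-! All grids are placed in one infinite graph, the `ladder`, as sets of vertices called regions.
Spanning trees become trees on a vertex set, and regions are compared by symmetries and by stripping
leaves. The counting principle is `ncard_joinedTrees`: trees on A ∪ B whose only edge between A and
B is uv correspond to pairs of trees on A and on B. Each count thus reduces to finding the connected
bipartitions involved.

For T, distinguish whether a tree uses the last rung. If not, both vertices of the last column are
leaves. If so, cutting the rung leaves a final segment of one row on one side and a region on the
other (`region_of_separates_last`). This gives `T_succ`, hence T(n+2) = 4 T(n+1) - T(n) and, with α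
= 2 + √3 and β = 2 - √3, T(n) = (αⁿ - βⁿ)/(2√3).

For S, a tree has at most one balanced cut (`joinedTrees_balanced_unique`). The half containing a
fixed corner consists of the first k vertices of one row and the first n - k of the other
(`region_of_balanced`), and a half turn carries it to the other half. For 0 < k < n each half
carries T(min(k, n-k)) trees and |n - 2k| + 2 edges join the halves; for k = 0 the halves are the
two rows, joined by n rungs. Summing over k gives `S_succ`. The identities `sum_T_sq` and
`sum_mul_T_sq` evaluate the sum through a few values of T, their squares and a quadratic polynomial
in n. Dividing by T(n) ~ αⁿ/(2√3) yields both limits. -/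

namespace BalancedTrees

open SimpleGraph Filter Topology

/-! ### Trees on vertex subsets and their cuts, in an arbitrary graph -/

section General

variable {V W : Type*}

/-- A map sending every edge to an edge or to a single vertex preserves reachability. -/
theorem reachable_of_collapse {H : SimpleGraph V} {K : SimpleGraph W} (φ : V → W)
    (h : ∀ x y, H.Adj x y → φ x = φ y ∨ K.Adj (φ x) (φ y)) {x y : V} (hxy : H.Reachable x y) :
    K.Reachable (φ x) (φ y) := by
  obtain ⟨p⟩ := hxy
  induction p with
  | nil => exact Reachable.refl _
  | cons hadj _ ih =>
    rcases h _ _ hadj with h' | h'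
    · rw [h']; exact ih
    · exact h'.reachable.trans ih

/-- A set closed under adjacency is closed under reachability. -/
theorem mem_of_reachable {H : SimpleGraph V} {X : Set V}
    (hX : ∀ x y, H.Adj x y → x ∈ X → y ∈ X) {x y : V} (hxy : H.Reachable x y) (hx : x ∈ X) :
    y ∈ X := by
  obtain ⟨p⟩ := hxy
  induction p with
  | nil => exact hx
  | cons hadj _ ih => exact ih (hX _ _ hadj hx)

/-- If a set separates two vertices joined by a walk, then some edge crosses its boundary. -/
theorem exists_adj_of_reachable {H : SimpleGraph V} {X : Set V} {x y : V}
    (hxy : H.Reachable x y) (hx : x ∈ X) (hy : y ∉ X) : ∃ a b, H.Adj a b ∧ a ∈ X ∧ b ∉ X := by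
  by_contra! hcon
  exact hy (mem_of_reachable hcon hxy hx)

/-- `H` is a tree with vertex set `A`, all other vertices being isolated. -/
structure IsTreeOn (H : SimpleGraph V) (A : Set V) : Prop where
  nonempty : A.Nonempty
  mem_of_adj : ∀ ⦃x y⦄, H.Adj x y → x ∈ A
  acyclic : H.IsAcyclic
  reachable : ∀ ⦃x⦄, x ∈ A → ∀ ⦃y⦄, y ∈ A → H.Reachable x y

/-- The subtrees of `G` with vertex set `A`. -/
def treesOn (G : SimpleGraph V) (A : Set V) : Set (SimpleGraph V) :=
  {H | H ≤ G ∧ IsTreeOn H A}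

/-- The subtrees of `G` with vertex set `A ∪ B` whose only edge between `A` and `B` joins `u`
to `v`. -/
def joinedTrees (G : SimpleGraph V) (A B : Set V) (u v : V) : Set (SimpleGraph V) :=
  {H | H ≤ G ∧ IsTreeOn H (A ∪ B) ∧ H.Adj u v ∧ ∀ x ∈ A, ∀ y ∈ B, H.Adj x y → x = u ∧ y = v}

/-- The edges of `H` with both ends in `A`. -/
def restrict (H : SimpleGraph V) (A : Set V) : SimpleGraph V where
  Adj x y := H.Adj x y ∧ x ∈ A ∧ y ∈ A
  symm := ⟨fun _ _ h => ⟨h.1.symm, h.2.2, h.2.1⟩⟩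
  loopless := ⟨fun _ h => h.1.ne rfl⟩

theorem restrict_le (H : SimpleGraph V) (A : Set V) : restrict H A ≤ H := fun _ _ h => h.1

theorem spanningTrees_eq_treesOn (G : SimpleGraph V) : spanningTrees G = treesOn G Set.univ := by
  ext H
  constructor
  · rintro ⟨h, ht⟩
    have := ht.1.nonempty
    exact ⟨h, Set.univ_nonempty, fun _ _ _ => trivial, ht.2, fun x _ y _ => ht.1.preconnected x y⟩
  · rintro ⟨h, ht⟩
    have : Nonempty V := ht.nonempty.to_type
    exact ⟨h, ⟨⟨fun x y => ht.reachable trivial trivial⟩, ht.acyclic⟩⟩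

theorem joinedTrees_symm (G : SimpleGraph V) (A B : Set V) (u v : V) :
    joinedTrees G A B u v = joinedTrees G B A v u := by
  ext H
  simp only [joinedTrees, Set.mem_ofPred_eq, Set.union_comm A B, H.adj_comm u v]
  refine and_congr_right fun _ => and_congr_right fun _ => and_congr_right fun _ => ?_
  exact ⟨fun h x hx y hy hxy => (h y hy x hx hxy.symm).symm,
    fun h x hx y hy hxy => (h y hy x hx hxy.symm).symm⟩

/-- Collapse B onto u. The only edge between A and B is uv, so a walk of H between vertices of A
becomes a walk inside A. -/
theorem isTreeOn_restrict {G H : SimpleGraph V} {A B : Set V} {u v : V}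
    (hu : u ∈ A) (h : H ∈ joinedTrees G A B u v) : IsTreeOn (restrict H A) A := by
  classical
  obtain ⟨-, ht, -, hcross⟩ := h
  refine ⟨⟨u, hu⟩, fun x y h => h.2.1, ht.acyclic.anti (restrict_le _ _), fun x hx y hy => ?_⟩
  have := reachable_of_collapse (H := H) (K := restrict H A) (fun w => if w ∈ A then w else u) ?_
    (ht.reachable (Or.inl hx) (Or.inl hy))
  · simpa [hx, hy] using this
  · intro a b hab
    have ha := ht.mem_of_adj hab
    have hb := ht.mem_of_adj hab.symm
    by_cases haA : a ∈ A <;> by_cases hbA : b ∈ A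
    · right; simp [haA, hbA, restrict, hab]
    · left
      simp [hbA, (hcross a haA b (hb.resolve_left hbA) hab).1]
    · left
      simp [haA, (hcross b hbA a (ha.resolve_left haA) hab.symm).1]
    · left; simp [haA, hbA]

/-- Collapsing the complement of A onto u contracts every edge of J outside H. A path of J avoiding
xy would therefore give a path of H avoiding xy. This is how acyclicity passes from the two parts to
their join. -/
theorem isBridge_of_join {H J : SimpleGraph V} {A : Set V} {u x y : V} (hu : u ∈ A)
    (hH : IsTreeOn H A) (hxy : H.Adj x y)
    (hJ : ∀ a b, J.Adj a b → H.Adj a b ∨ (a ∉ A ∨ a = u) ∧ (b ∉ A ∨ b = u)) :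
    J.IsBridge s(x, y) := by
  classical
  have hb := isAcyclic_iff_forall_adj_isBridge.1 hH.acyclic hxy
  rw [isBridge_iff] at hb ⊢
  intro hr
  apply hb
  have hx := hH.mem_of_adj hxy
  have hy := hH.mem_of_adj hxy.symm
  have := reachable_of_collapse (K := H.deleteEdges {s(x, y)})
    (fun w => if w ∈ A then w else u) ?_ hr
  · simpa [hx, hy] using this
  · intro a b hab
    rw [deleteEdges_adj] at hab
    rcases hJ a b hab.1 with h | ⟨h1, h2⟩
    · right
      have ha := hH.mem_of_adj h
      have hb := hH.mem_of_adj h.symm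
      simpa [ha, hb, h] using hab.2
    · left
      rcases h1 with h1 | rfl <;> rcases h2 with h2 | rfl <;> simp_all

theorem join_mem_joinedTrees {G H K : SimpleGraph V} {A B : Set V} {u v : V} (hAB : Disjoint A B)
    (hu : u ∈ A) (hv : v ∈ B) (huv : G.Adj u v) (hH : H ∈ treesOn G A) (hK : K ∈ treesOn G B) :
    H ⊔ K ⊔ edge u v ∈ joinedTrees G A B u v := by
  obtain ⟨hHG, hH⟩ := hH
  obtain ⟨hKG, hK⟩ := hK
  have hne := huv.ne
  have hd : ∀ x, x ∈ A → x ∉ B := fun _ hx => Set.disjoint_left.1 hAB hx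
  have hadj : ∀ a b, (H ⊔ K ⊔ edge u v).Adj a b ↔
      H.Adj a b ∨ K.Adj a b ∨ (a = u ∧ b = v ∨ a = v ∧ b = u) := by
    intro a b
    simp only [sup_adj, edge_adj, or_assoc]
    grind
  have h1 := hH.mem_of_adj
  have h2 := hK.mem_of_adj
  have h1' : ∀ x y, H.Adj x y → y ∈ A := fun x y h => h1 h.symm
  have h2' : ∀ x y, K.Adj x y → y ∈ B := fun x y h => h2 h.symm
  have hHle : H ≤ H ⊔ K ⊔ edge u v := le_sup_left.trans le_sup_left
  have hKle : K ≤ H ⊔ K ⊔ edge u v := le_sup_right.trans le_sup_left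
  have huvJ : (H ⊔ K ⊔ edge u v).Adj u v := (hadj _ _).2 (by simp)
  have hcross : ∀ x ∈ A, ∀ y ∈ B, (H ⊔ K ⊔ edge u v).Adj x y → x = u ∧ y = v := by
    intro x hx y hy hxy
    rw [hadj] at hxy
    grind
  refine ⟨?_, ⟨⟨u, Or.inl hu⟩, ?_, ?_, ?_⟩, huvJ, hcross⟩
  · intro a b hab
    rw [hadj] at hab
    rcases hab with h | h | ⟨rfl, rfl⟩ | ⟨rfl, rfl⟩
    exacts [hHG h, hKG h, huv, huv.symm]
  · intro a b hab
    rw [hadj] at hab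
    rw [Set.mem_union]
    grind
  · rw [isAcyclic_iff_forall_adj_isBridge]
    intro x y hxy
    have hcut : (H ⊔ K ⊔ edge u v).IsBridge s(u, v) := by
      rw [isBridge_iff]
      intro hr
      refine hd v (mem_of_reachable (X := A) ?_ hr hu) hv
      intro a b hab ha
      rw [deleteEdges_adj, hadj] at hab
      obtain ⟨hab, hne'⟩ := hab
      simp only [Set.mem_singleton_iff, Sym2.eq_iff] at hne'
      grind
    rcases (hadj x y).1 hxy with h | h | ⟨rfl, rfl⟩ | ⟨rfl, rfl⟩
    · refine isBridge_of_join hu hH h fun a b hab => ?_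
      rw [hadj] at hab
      grind
    · refine isBridge_of_join hv hK h fun a b hab => ?_
      rw [hadj] at hab
      grind
    · exact hcut
    · rwa [Sym2.eq_swap]
  · have key : ∀ x ∈ A ∪ B, (H ⊔ K ⊔ edge u v).Reachable u x := by
      rintro x (hx | hx)
      · exact (hH.reachable hu hx).mono hHle
      · exact huvJ.reachable.trans ((hK.reachable hv hx).mono hKle)
    exact fun x hx y hy => (key x hx).symm.trans (key y hy)

/-- A tree with a single edge between `A` and `B` amounts to a tree on `A` and a tree on `B`. -/
theorem ncard_joinedTrees {G : SimpleGraph V} {A B : Set V} {u v : V} (hAB : Disjoint A B)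
    (hu : u ∈ A) (hv : v ∈ B) (huv : G.Adj u v) :
    (joinedTrees G A B u v).ncard = (treesOn G A).ncard * (treesOn G B).ncard := by
  rw [← Set.ncard_prod]
  symm
  have hd : ∀ x, x ∈ A → x ∉ B := fun _ hx => Set.disjoint_left.1 hAB hx
  have hres : ∀ H K : SimpleGraph V, IsTreeOn H A → IsTreeOn K B →
      restrict (H ⊔ K ⊔ edge u v) A = H ∧ restrict (H ⊔ K ⊔ edge u v) B = K := by
    intro H K hH hK
    have h1 := hH.mem_of_adj
    have h2 := hK.mem_of_adj
    have h1' : ∀ x y, H.Adj x y → y ∈ A := fun x y h => h1 h.symm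
    have h2' : ∀ x y, K.Adj x y → y ∈ B := fun x y h => h2 h.symm
    constructor <;> ext a b <;> simp only [restrict, sup_adj, edge_adj] <;> grind
  refine Set.ncard_congr (fun p _ => p.1 ⊔ p.2 ⊔ edge u v) ?_ ?_ ?_
  · rintro ⟨H, K⟩ ⟨hH, hK⟩
    exact join_mem_joinedTrees hAB hu hv huv hH hK
  · rintro ⟨H, K⟩ ⟨H', K'⟩ ⟨hH, hK⟩ ⟨hH', hK'⟩ heq
    have h1 := hres H K hH.2 hK.2
    have h2 := hres H' K' hH'.2 hK'.2
    simp only at heq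
    rw [heq] at h1
    exact Prod.ext (h1.1.symm.trans h2.1) (h1.2.symm.trans h2.2)
  · intro J hJ
    have hJA := isTreeOn_restrict hu hJ
    have hJB := isTreeOn_restrict hv ((joinedTrees_symm G A B u v).subset hJ)
    refine ⟨(restrict J A, restrict J B),
      ⟨⟨(restrict_le _ _).trans hJ.1, hJA⟩, ⟨(restrict_le _ _).trans hJ.1, hJB⟩⟩, ?_⟩
    obtain ⟨-, ht, hJuv, hcross⟩ := hJ
    have hJvu := hJuv.symm
    ext a b
    simp only [restrict, sup_adj, edge_adj]
    have hm : J.Adj a b → (a ∈ A ∨ a ∈ B) ∧ (b ∈ A ∨ b ∈ B) :=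
      fun h => ⟨ht.mem_of_adj h, ht.mem_of_adj h.symm⟩
    have hc1 := hcross a
    have hc2 := hcross b
    have hs := J.adj_comm a b
    grind

theorem joinedTrees_subset_of_closed {G H : SimpleGraph V} {A B X : Set V} {u v w : V}
    (hu : u ∈ A) (h : H ∈ joinedTrees G A B u v)
    (hX : ∀ x ∈ A, ∀ y ∈ A, H.Adj x y → x ∈ X → y ∈ X) (hwA : w ∈ A) (hwX : w ∈ X) : A ⊆ X :=
  fun _ hy => mem_of_reachable (H := restrict H A)
    (fun a b hab haX => hX a hab.2.1 b hab.2.2 hab.1 haX)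
    ((isTreeOn_restrict hu h).reachable hwA hy) hwX

/-- The side `A` of a cut of a tree lies on one side of a second cut, unless it contains the edge
of the second cut. -/
theorem joinedTrees_subset {G H : SimpleGraph V} {A B A' B' : Set V} {u v u' v' w : V}
    (hu : u ∈ A) (h : H ∈ joinedTrees G A B u v) (h' : H ∈ joinedTrees G A' B' u' v')
    (hne : ¬ (u' ∈ A ∧ v' ∈ A)) (hwA : w ∈ A) (hwA' : w ∈ A') : A ⊆ A' := by
  refine joinedTrees_subset_of_closed hu h (fun x hx y hy hxy hxA' => ?_) hwA hwA'
  by_contra hyA'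
  obtain ⟨rfl, rfl⟩ := h'.2.2.2 x hxA' y ((h'.2.1.mem_of_adj hxy.symm).resolve_left hyA') hxy
  exact hne ⟨hx, hy⟩

/-- A cut of a tree is determined by its edge. -/
theorem joinedTrees_side_unique {G H : SimpleGraph V} {A B A' B' : Set V} {u v : V}
    (hAB : Disjoint A B) (hAB' : Disjoint A' B') (hu : u ∈ A) (hv : v ∈ B) (hu' : u ∈ A')
    (hv' : v ∈ B') (h : H ∈ joinedTrees G A B u v) (h' : H ∈ joinedTrees G A' B' u v) : A = A' :=
  (joinedTrees_subset hu h h' (fun hh => Set.disjoint_left.1 hAB hh.2 hv) hu hu').antisymm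
    (joinedTrees_subset hu' h' h (fun hh => Set.disjoint_left.1 hAB' hh.2 hv') hu'
      hu)

/-- A tree has at most one cut into two halves of equal size. -/
theorem joinedTrees_balanced_unique {G H : SimpleGraph V} {A B A' B' C : Set V} {u v u' v' w : V}
    (hC : C.Finite) (hAB : Disjoint A B) (hAB' : Disjoint A' B') (hABC : A ∪ B = C)
    (hABC' : A' ∪ B' = C) (hu : u ∈ A) (hv : v ∈ B) (hcard : A.ncard = B.ncard)
    (hcard' : A'.ncard = B'.ncard) (hw : w ∈ A) (hw' : w ∈ A') (h : H ∈ joinedTrees G A B u v)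
    (h' : H ∈ joinedTrees G A' B' u' v') : A = A' ∧ u = u' ∧ v = v' := by
  have hA : A.Finite := hC.subset (hABC ▸ Set.subset_union_left)
  have hB : B.Finite := hC.subset (hABC ▸ Set.subset_union_right)
  have hA' : A'.Finite := hC.subset (hABC' ▸ Set.subset_union_left)
  have hB' : B'.Finite := hC.subset (hABC' ▸ Set.subset_union_right)
  have hs := Set.ncard_union_eq hAB hA hB
  have hs' := Set.ncard_union_eq hAB' hA' hB'
  rw [hABC] at hs
  rw [hABC'] at hs'
  -- If the second cut edge is not inside A, then A lies in A', and equal sizes force equality.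
  -- Otherwise that edge is not inside B, so B lies in A' or in B' and equals it. The former is
  -- impossible because w is in both A and A'; the latter gives A = A'.
  have hsub : A = A' := by
    by_cases hne : u' ∈ A ∧ v' ∈ A
    · have hneB : ¬ (u' ∈ B ∧ v' ∈ B) := fun hh => Set.disjoint_left.1 hAB hne.1 hh.1
      have hneB' : ¬ (v' ∈ B ∧ u' ∈ B) := fun hh => Set.disjoint_left.1 hAB hne.1 hh.2
      have hr := (joinedTrees_symm G A B u v).subset h
      have hr' := (joinedTrees_symm G A' B' u' v').subset h'
      have hvC : v ∈ A' ∪ B' := by rw [hABC', ← hABC]; exact Or.inr hv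
      rcases hvC with hvA' | hvB'
      · have := Set.eq_of_subset_of_ncard_le (joinedTrees_subset hv hr h' hneB hv hvA')
          (by omega) hA'
        exact absurd (this ▸ hw') (Set.disjoint_left.1 hAB hw)
      · have := Set.eq_of_subset_of_ncard_le (joinedTrees_subset hv hr hr' hneB' hv hvB')
          (by omega) hB'
        subst this
        have h1 : A = C \ B := by rw [← hABC, Set.union_sdiff_cancel_right hAB.le_bot]
        have h2 : A' = C \ B := by rw [← hABC', Set.union_sdiff_cancel_right hAB'.le_bot]
        rw [h1, h2]
    · exact Set.eq_of_subset_of_ncard_le (joinedTrees_subset hu h h' hne hw hw') (by omega) hA'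
  subst hsub
  have h1 : B = C \ A := by rw [← hABC, Set.union_sdiff_cancel_left hAB.le_bot]
  have h2 : B' = C \ A := by rw [← hABC', Set.union_sdiff_cancel_left hAB'.le_bot]
  rw [h2, ← h1] at h'
  exact ⟨rfl, h'.2.2.2 u hu v hv h.2.2.1⟩

/-! ### Counting trees: leaves and graph embeddings -/

theorem ncard_treesOn_singleton (G : SimpleGraph V) (v : V) : (treesOn G {v}).ncard = 1 := by
  rw [Set.ncard_eq_one]
  refine ⟨⊥, Set.eq_singleton_iff_unique_mem.2 ⟨⟨bot_le, ⟨v, rfl⟩, ?_, isAcyclic_bot, ?_⟩, ?_⟩⟩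
  · intro x y h; exact absurd h (by simp)
  · rintro x rfl y rfl; exact Reachable.refl _
  · rintro H ⟨-, hH⟩
    ext x y
    simp only [bot_adj, iff_false]
    intro h
    have hx : x = v := hH.mem_of_adj h
    have hy : y = v := hH.mem_of_adj h.symm
    exact h.ne (hx.trans hy.symm)

/-- Adding a vertex with a single neighbour does not change the number of trees. -/
theorem ncard_treesOn_insert {G : SimpleGraph V} {A : Set V} {u v : V} (hu : u ∈ A) (hv : v ∉ A)
    (huv : G.Adj u v) (h : ∀ x ∈ A, G.Adj x v → x = u) :
    (treesOn G (insert v A)).ncard = (treesOn G A).ncard := by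
  -- Some edge of the tree must leave A, and uv is the only edge of G that can.
  have heq : treesOn G (insert v A) = joinedTrees G A {v} u v := by
    rw [← Set.union_singleton]
    ext H
    refine ⟨fun ⟨hHG, hH⟩ => ⟨hHG, hH, ?_, ?_⟩, fun hH => ⟨hH.1, hH.2.1⟩⟩
    · obtain ⟨a, b, hab, ha, hb⟩ := exists_adj_of_reachable (X := A)
        (hH.reachable (Or.inl hu) (Or.inr rfl)) hu hv
      have hb' : b = v := (hH.mem_of_adj hab.symm).resolve_left hb
      subst hb'
      rwa [← h a ha (hHG hab)]
    · rintro x hx y rfl hxy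
      exact ⟨h x hx (hHG hxy), rfl⟩
  rw [heq, ncard_joinedTrees (Set.disjoint_singleton_right.2 hv) hu (Set.mem_singleton v) huv,
    ncard_treesOn_singleton, mul_one]

/-- Walks of the image are pulled back along a left inverse of f; every edge of the image joins
values of f, so what the inverse does elsewhere is irrelevant. -/
theorem isTreeOn_map (f : V ↪ W) {H : SimpleGraph V} {A : Set V} :
    IsTreeOn (H.map f) (f '' A) ↔ IsTreeOn H A := by
  classical
  constructor
  · intro h
    refine ⟨Set.image_nonempty.1 h.nonempty, fun x y hxy => ?_, h.acyclic.of_map,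
      fun x hx y hy => ?_⟩
    · exact (f.injective.mem_set_image).1
        (h.mem_of_adj ((SimpleGraph.map_adj _ _ _ _).2 ⟨x, y, hxy, rfl, rfl⟩))
    · have : Nonempty V := ⟨x⟩
      have := reachable_of_collapse (K := H) (Function.invFun f) ?_
        (h.reachable (Set.mem_image_of_mem f hx) (Set.mem_image_of_mem f hy))
      · simpa [Function.leftInverse_invFun f.injective _] using this
      · rintro _ _ hab
        obtain ⟨a, b, hab, rfl, rfl⟩ := (SimpleGraph.map_adj _ _ _ _).1 hab
        right
        simpa [Function.leftInverse_invFun f.injective _] using hab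
  · intro h
    refine ⟨h.nonempty.image f, ?_, ?_, ?_⟩
    · rintro _ _ hab
      obtain ⟨a, b, hab', rfl, rfl⟩ := (SimpleGraph.map_adj _ _ _ _).1 hab
      exact Set.mem_image_of_mem f (h.mem_of_adj hab')
    · rw [isAcyclic_iff_forall_adj_isBridge]
      rintro _ _ hab
      obtain ⟨a, b, hab', rfl, rfl⟩ := (SimpleGraph.map_adj _ _ _ _).1 hab
      have hb := isAcyclic_iff_forall_adj_isBridge.1 h.acyclic hab'
      rw [isBridge_iff] at hb ⊢
      refine fun hr => hb ?_
      have : Nonempty V := ⟨a⟩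
      have := reachable_of_collapse (K := H.deleteEdges {s(a, b)}) (Function.invFun f) ?_ hr
      · simpa [Function.leftInverse_invFun f.injective _] using this
      · rintro _ _ hcd
        rw [deleteEdges_adj] at hcd
        obtain ⟨c, d, hcd', rfl, rfl⟩ := (SimpleGraph.map_adj _ _ _ _).1 hcd.1
        right
        simpa [Function.leftInverse_invFun f.injective _, hcd'] using hcd.2
    · rintro _ ⟨x, hx, rfl⟩ _ ⟨y, hy, rfl⟩
      exact (h.reachable hx hy).map (SimpleGraph.Embedding.map f H).toHom

theorem exists_map_eq (f : V ↪ W) {G : SimpleGraph V} {K J : SimpleGraph W}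
    (hf : ∀ x y, G.Adj x y ↔ K.Adj (f x) (f y)) (hJ : J ≤ K)
    (hr : ∀ x y, J.Adj x y → x ∈ Set.range f) : ∃ H ≤ G, H.map f = J := by
  refine ⟨J.comap f, fun x y h => (hf x y).2 (hJ h), ?_⟩
  ext x y
  rw [SimpleGraph.map_adj]
  constructor
  · rintro ⟨a, b, h, rfl, rfl⟩; exact h
  · intro h
    obtain ⟨a, rfl⟩ := hr _ _ h
    obtain ⟨b, rfl⟩ := hr _ _ h.symm
    exact ⟨a, b, h, rfl, rfl⟩

theorem map_le_of_adj_iff (f : V ↪ W) {G H : SimpleGraph V} {K : SimpleGraph W}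
    (hf : ∀ x y, G.Adj x y ↔ K.Adj (f x) (f y)) (hH : H ≤ G) : H.map f ≤ K := by
  rintro _ _ h
  obtain ⟨a, b, hab, rfl, rfl⟩ := (SimpleGraph.map_adj _ _ _ _).1 h
  exact (hf a b).1 (hH hab)

/-- The number of trees on a set of vertices is preserved by embeddings of graphs. -/
theorem ncard_treesOn_image (f : V ↪ W) {G : SimpleGraph V} {K : SimpleGraph W}
    (hf : ∀ x y, G.Adj x y ↔ K.Adj (f x) (f y)) (A : Set V) :
    (treesOn K (f '' A)).ncard = (treesOn G A).ncard := by
  have : treesOn K (f '' A) = SimpleGraph.map f '' treesOn G A := by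
    ext J
    constructor
    · rintro ⟨hJ, ht⟩
      obtain ⟨H, hH, rfl⟩ := exists_map_eq f hf hJ
        fun x y h => Set.image_subset_range _ _ (ht.mem_of_adj h)
      exact ⟨H, ⟨hH, (isTreeOn_map f).1 ht⟩, rfl⟩
    · rintro ⟨H, ⟨hH, ht⟩, rfl⟩
      exact ⟨map_le_of_adj_iff f hf hH, (isTreeOn_map f).2 ht⟩
  rw [this, Set.ncard_image_of_injective _ (SimpleGraph.map_injective f)]

theorem map_mem_joinedTrees (f : V ↪ W) {G H : SimpleGraph V} {K : SimpleGraph W}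
    (hf : ∀ x y, G.Adj x y ↔ K.Adj (f x) (f y)) (hH : H ≤ G) {A B : Set V} {u v : V} :
    H.map f ∈ joinedTrees K (f '' A) (f '' B) (f u) (f v) ↔ H ∈ joinedTrees G A B u v := by
  have hadj : ∀ x y, (H.map f).Adj (f x) (f y) ↔ H.Adj x y := fun x y => map_adj_apply
  simp only [joinedTrees, Set.mem_ofPred_eq, ← Set.image_union, isTreeOn_map, hadj, hH,
    map_le_of_adj_iff f hf hH, Set.forall_mem_image, f.injective.eq_iff]

/-! ### Balanced trees in terms of cuts -/

/-- The two components left by a balanced cut edge are A and its complement, and only that edge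
joins them. Conversely both sides of the cut stay connected after the deletion, and no remaining
edge joins them. -/
theorem mem_balancedSpanningTrees_iff {G H : SimpleGraph V} :
    H ∈ balancedSpanningTrees G ↔ ∃ (A : Set V) (u v : V), u ∈ A ∧ v ∈ Aᶜ ∧ A.ncard = Aᶜ.ncard ∧
      H ∈ joinedTrees G A Aᶜ u v := by
  constructor
  · rintro ⟨hH, e, he, C, D, hCD, hall, hcard⟩
    rw [spanningTrees_eq_treesOn] at hH
    have hcompl : C.suppᶜ = D.supp := by
      ext x
      simp only [Set.mem_compl_iff, ConnectedComponent.mem_supp_iff]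
      rcases hall ((H.deleteEdges {e}).connectedComponentMk x) with h | h <;> rw [h] <;>
        simp [hCD, hCD.symm]
    obtain ⟨x, hx⟩ := C.nonempty_supp
    obtain ⟨y, hy⟩ := D.nonempty_supp
    rw [← hcompl] at hy
    have hcross : ∀ a ∈ C.supp, ∀ b ∈ C.suppᶜ, H.Adj a b → s(a, b) = e := by
      intro a ha b hb hab
      by_contra hne
      refine hb ?_
      rw [ConnectedComponent.mem_supp_iff] at ha ⊢
      rw [← ha, ConnectedComponent.eq]
      exact Adj.reachable (by rw [deleteEdges_adj]; exact ⟨hab.symm, by simpa [Sym2.eq_swap] using hne⟩)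
    obtain ⟨u, v, huv, hu, hv⟩ := exists_adj_of_reachable (hH.2.reachable (x := x) trivial
      (y := y) trivial) hx hy
    refine ⟨C.supp, u, v, hu, hv, by rw [hcompl, hcard], hH.1,
      by rw [Set.union_compl_self]; exact hH.2, huv, fun a ha b hb hab => ?_⟩
    have := (hcross a ha b hb hab).trans (hcross u hu v hv huv).symm
    rw [Sym2.eq_iff] at this
    rcases this with h | ⟨rfl, rfl⟩
    · exact h
    · exact absurd ha hv
  · rintro ⟨A, u, v, hu, hv, hcard, hH⟩
    have hAB : Disjoint A Aᶜ := disjoint_compl_right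
    have htA := isTreeOn_restrict hu hH
    have htB := isTreeOn_restrict hv ((joinedTrees_symm _ _ _ _ _).subset hH)
    have hle : ∀ X : Set V, (X = A ∨ X = Aᶜ) → restrict H X ≤ H.deleteEdges {s(u, v)} := by
      rintro X hX a b ⟨hab, ha, hb⟩
      rw [deleteEdges_adj]
      refine ⟨hab, fun h => ?_⟩
      rw [Set.mem_singleton_iff, Sym2.eq_iff] at h
      rcases hX with rfl | rfl <;> rcases h with ⟨rfl, rfl⟩ | ⟨rfl, rfl⟩
      exacts [hv hb, hv ha, ha hu, hb hu]
    have hclosed : ∀ a b, (H.deleteEdges {s(u, v)}).Adj a b → a ∈ A → b ∈ A := by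
      intro a b hab ha
      rw [deleteEdges_adj] at hab
      by_contra hb
      obtain ⟨rfl, rfl⟩ := hH.2.2.2 a ha b hb hab.1
      exact hab.2 rfl
    have hA : ((H.deleteEdges {s(u, v)}).connectedComponentMk u).supp = A := by
      ext x
      rw [ConnectedComponent.mem_supp_iff, ConnectedComponent.eq]
      exact ⟨fun h => mem_of_reachable hclosed h.symm hu,
        fun h => (htA.reachable h hu).mono (hle A (Or.inl rfl))⟩
    have hB : ((H.deleteEdges {s(u, v)}).connectedComponentMk v).supp = Aᶜ := by
      ext x
      rw [ConnectedComponent.mem_supp_iff, ConnectedComponent.eq]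
      exact ⟨fun h hx => hv (mem_of_reachable hclosed h hx),
        fun h => (htB.reachable h hv).mono (hle Aᶜ (Or.inr rfl))⟩
    refine ⟨?_, s(u, v), hH.2.2.1, (H.deleteEdges {s(u, v)}).connectedComponentMk u,
      (H.deleteEdges {s(u, v)}).connectedComponentMk v, ?_, ?_, by rw [hA, hB, hcard]⟩
    · rw [spanningTrees_eq_treesOn, ← Set.union_compl_self A]
      exact ⟨hH.1, hH.2.1⟩
    · intro h
      rw [h] at hA
      exact hv (hA ▸ hB.symm ▸ hv)
    · intro K
      induction K using ConnectedComponent.ind with | _ x =>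
      by_cases hx : x ∈ A
      · left; rwa [← hA] at hx
      · right; have hxc : x ∈ Aᶜ := hx
        rwa [← hB] at hxc

/-- The balanced trees on a vertex set `C`, in terms of their cut into two halves. -/
def balancedTreesOn (G : SimpleGraph V) (C : Set V) : Set (SimpleGraph V) :=
  {H | ∃ (A B : Set V) (u v : V), Disjoint A B ∧ A ∪ B = C ∧ u ∈ A ∧ v ∈ B ∧ A.ncard = B.ncard ∧
    H ∈ joinedTrees G A B u v}

theorem ncard_balancedTreesOn_range (f : V ↪ W) {G : SimpleGraph V} {K : SimpleGraph W}
    (hf : ∀ x y, G.Adj x y ↔ K.Adj (f x) (f y)) :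
    (balancedTreesOn K (Set.range f)).ncard = (balancedSpanningTrees G).ncard := by
  have : balancedTreesOn K (Set.range f) = SimpleGraph.map f '' balancedSpanningTrees G := by
    ext J
    constructor
    · rintro ⟨A, B, u, v, hAB, hC, hu, hv, hcard, hJ⟩
      have hB : B = f '' (f ⁻¹' A)ᶜ := by
        rw [← Set.preimage_compl, Set.image_preimage_eq_inter_range, ← hC]
        ext x
        have : x ∈ A → x ∉ B := fun hx => Set.disjoint_left.1 hAB hx
        simp only [Set.mem_inter_iff, Set.mem_compl_iff, Set.mem_union]
        tauto
      have hA : A = f '' (f ⁻¹' A) := by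
        rw [Set.image_preimage_eq_inter_range, ← hC]
        simp
      generalize f ⁻¹' A = A' at hA hB
      subst hA hB
      obtain ⟨u, hu, rfl⟩ := hu
      obtain ⟨v, hv, rfl⟩ := hv
      obtain ⟨H, hH, rfl⟩ := exists_map_eq f hf hJ.1
        fun x y h => hC ▸ hJ.2.1.mem_of_adj h
      rw [map_mem_joinedTrees f hf hH] at hJ
      rw [Set.ncard_image_of_injective _ f.injective,
        Set.ncard_image_of_injective _ f.injective] at hcard
      exact ⟨H, mem_balancedSpanningTrees_iff.2 ⟨A', u, v, hu, hv, hcard, hJ⟩, rfl⟩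
    · rintro ⟨H, hH, rfl⟩
      obtain ⟨A, u, v, hu, hv, hcard, hH⟩ := mem_balancedSpanningTrees_iff.1 hH
      refine ⟨f '' A, f '' Aᶜ, f u, f v, ?_, ?_, Set.mem_image_of_mem f hu,
        Set.mem_image_of_mem f hv, ?_, (map_mem_joinedTrees f hf hH.1).2 hH⟩
      · exact (Set.disjoint_image_iff f.injective).2 disjoint_compl_right
      · rw [← Set.image_union, Set.union_compl_self, Set.image_univ]
      · rwa [Set.ncard_image_of_injective _ f.injective, Set.ncard_image_of_injective _ f.injective]
  rw [this, Set.ncard_image_of_injective _ (SimpleGraph.map_injective f)]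

/-- A tree on A is determined by its adjacent pairs, which form a subset of A × A. Finiteness has to
be proved because the ambient ladder is infinite and `ncard` is 0 on infinite sets. -/
theorem finite_treesOn (G : SimpleGraph V) {A : Set V} (hA : A.Finite) : (treesOn G A).Finite := by
  have hinj : Set.InjOn (fun H : SimpleGraph V => {p : V × V | H.Adj p.1 p.2}) (treesOn G A) := by
    intro H _ K _ h
    ext x y
    have hxy : (x, y) ∈ {p : V × V | H.Adj p.1 p.2} ↔ (x, y) ∈ {p : V × V | K.Adj p.1 p.2} := by
      simp only at h
      rw [h]
    simpa using hxy
  refine Set.Finite.of_finite_image ((hA.prod hA).finite_subsets.subset ?_) hinj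
  rintro _ ⟨H, ⟨-, hH⟩, rfl⟩ p hp
  exact ⟨hH.mem_of_adj hp, hH.mem_of_adj hp.symm⟩

theorem joinedTrees_subset_treesOn (G : SimpleGraph V) (A B : Set V) (u v : V) :
    joinedTrees G A B u v ⊆ treesOn G (A ∪ B) := fun _ h => ⟨h.1, h.2.1⟩

end General
theorem ncard_biUnion_finset {ι α : Type*} (s : Finset ι) (F : ι → Set α)
    (hF : ∀ i ∈ s, (F i).Finite) (hd : ∀ i ∈ s, ∀ j ∈ s, i ≠ j → Disjoint (F i) (F j)) :
    (⋃ i ∈ s, F i).ncard = ∑ i ∈ s, (F i).ncard := by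
  have := s.finite_toSet.ncard_biUnion (s := F) hF (fun i hi j hj hij => hd i hi j hj hij)
  rw [finsum_mem_coe_finset] at this
  simpa using this

/-- Every edge of a tree cuts it into two parts. -/
theorem exists_mem_joinedTrees {V : Type*} {G H : SimpleGraph V} {C : Set V} {u v : V}
    (hH : H ∈ treesOn G C) (huv : H.Adj u v) : ∃ A B : Set V, Disjoint A B ∧ A ∪ B = C ∧ u ∈ A ∧
      v ∈ B ∧ H ∈ joinedTrees G A B u v := by
  obtain ⟨hHG, hH⟩ := hH
  set F := H.deleteEdges {s(u, v)} with hF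
  set A := {w | w ∈ C ∧ F.Reachable u w} with hA
  have hAC : A ∪ C \ A = C := Set.union_sdiff_cancel fun x hx => hx.1
  have hv : v ∉ A := by
    have := isAcyclic_iff_forall_adj_isBridge.1 hH.acyclic huv
    rw [isBridge_iff] at this
    exact fun h => this h.2
  refine ⟨A, C \ A, Set.disjoint_sdiff_right, hAC, ⟨hH.mem_of_adj huv, Reachable.refl _⟩,
    ⟨hH.mem_of_adj huv.symm, hv⟩, hHG, by rwa [hAC], huv, fun x hx y hy hxy => ?_⟩
  by_contra hne
  refine hy.2 ⟨hy.1, hx.2.trans (Adj.reachable ?_)⟩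
  rw [hF, deleteEdges_adj]
  refine ⟨hxy, fun h => ?_⟩
  rw [Set.mem_singleton_iff, Sym2.eq_iff] at h
  rcases h with h | ⟨rfl, rfl⟩
  exacts [hne h, hv hx]

/-! ### The ladder, its regions and their symmetries -/

/-- The ladder with two rows and a column for every integer. -/
def ladder : SimpleGraph (Bool × ℤ) where
  Adj p q := (p.1 ≠ q.1 ∧ p.2 = q.2) ∨ (p.1 = q.1 ∧ (p.2 + 1 = q.2 ∨ q.2 + 1 = p.2))
  symm := ⟨fun _ _ h => by
    rcases h with h | h
    · exact Or.inl ⟨h.1.symm, h.2.symm⟩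
    · exact Or.inr ⟨h.1.symm, h.2.symm⟩⟩
  loopless := ⟨fun _ h => by
    rcases h with h | h
    · exact h.1 rfl
    · omega⟩

theorem ladder_adj {p q : Bool × ℤ} : ladder.Adj p q ↔
    (p.1 ≠ q.1 ∧ p.2 = q.2) ∨ (p.1 = q.1 ∧ (p.2 + 1 = q.2 ∨ q.2 + 1 = p.2)) := Iff.rfl

/-- The first `a` vertices of one row of the ladder and the first `b` vertices of the other. -/
def region (a b : ℕ) : Set (Bool × ℤ) := {p | 0 ≤ p.2 ∧ p.2 < bif p.1 then (b : ℤ) else (a : ℤ)}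

@[simp] theorem mem_region_false {a b : ℕ} {i : ℤ} : (false, i) ∈ region a b ↔ 0 ≤ i ∧ i < a :=
  Iff.rfl

@[simp] theorem mem_region_true {a b : ℕ} {i : ℤ} : (true, i) ∈ region a b ↔ 0 ≤ i ∧ i < b :=
  Iff.rfl

theorem region_eq (a b : ℕ) : region a b =
    ({false} ×ˢ (Finset.Ico (0 : ℤ) a : Set ℤ)) ∪ ({true} ×ˢ (Finset.Ico (0 : ℤ) b : Set ℤ)) := by
  ext ⟨r, i⟩
  cases r <;> simp

theorem finite_region (a b : ℕ) : (region a b).Finite := by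
  rw [region_eq]
  exact ((Set.finite_singleton _).prod (Finset.finite_toSet _)).union
    ((Set.finite_singleton _).prod (Finset.finite_toSet _))

theorem ncard_region (a b : ℕ) : (region a b).ncard = a + b := by
  rw [region_eq, Set.ncard_union_eq]
  · rw [Set.ncard_prod, Set.ncard_prod, Set.ncard_coe_finset, Set.ncard_coe_finset]
    simp
  · rw [Set.disjoint_left]
    rintro ⟨r, i⟩ h h'
    simp_all

/-- The number of trees on a region of the ladder. -/
noncomputable def regionTrees (a b : ℕ) : ℕ := (treesOn ladder (region a b)).ncard

/-- The inclusion of the grid in the ladder. -/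
def gridEmbedding (n : ℕ) : Fin 2 × Fin n ↪ Bool × ℤ where
  toFun p := (decide (p.1 = 1), (p.2 : ℕ))
  inj' := by
    rintro ⟨r, i⟩ ⟨s, j⟩ h
    simp only [Prod.mk.injEq, Nat.cast_inj, decide_eq_decide] at h
    refine Prod.ext ?_ (Fin.ext h.2)
    have := h.1
    fin_cases r <;> fin_cases s <;> simp_all

theorem gridEmbedding_adj (n : ℕ) (p q : Fin 2 × Fin n) :
    (grid n).Adj p q ↔ ladder.Adj (gridEmbedding n p) (gridEmbedding n q) := by
  obtain ⟨r, i⟩ := p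
  obtain ⟨s, j⟩ := q
  simp only [grid, boxProd_adj, pathGraph_adj, ladder_adj, gridEmbedding,
    Function.Embedding.coeFn_mk, Fin.ext_iff]
  fin_cases r <;> fin_cases s <;> simp <;> omega

theorem gridEmbedding_apply (n : ℕ) (r : Fin 2) (i : Fin n) :
    gridEmbedding n (r, i) = (decide (r = 1), ((i : ℕ) : ℤ)) := rfl

theorem range_gridEmbedding (n : ℕ) : Set.range (gridEmbedding n) = region n n := by
  ext ⟨r, i⟩
  constructor
  · rintro ⟨⟨s, j⟩, h⟩
    rw [gridEmbedding_apply, Prod.mk.injEq] at h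
    obtain ⟨h1, rfl⟩ := h
    cases r <;> simp
  · intro h
    have hi : 0 ≤ i ∧ i < n := by cases r <;> simpa using h
    refine ⟨(if r then 1 else 0, ⟨i.toNat, by omega⟩), ?_⟩
    rw [gridEmbedding_apply]
    cases r <;> simp [hi.1]

theorem T_eq_regionTrees (n : ℕ) : T n = regionTrees n n := by
  rw [T, spanningTrees_eq_treesOn, ← ncard_treesOn_image _ (gridEmbedding_adj n), Set.image_univ,
    range_gridEmbedding, regionTrees]

theorem S_eq_ncard (n : ℕ) : S n = (balancedTreesOn ladder (region n n)).ncard := by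
  rw [S, ← ncard_balancedTreesOn_range _ (gridEmbedding_adj n), range_gridEmbedding]

theorem regionTrees_symm (a b : ℕ) : regionTrees a b = regionTrees b a := by
  let f : Bool × ℤ ↪ Bool × ℤ := ⟨fun p => (!p.1, p.2), by
    rintro ⟨r, i⟩ ⟨s, j⟩ h
    simpa using h⟩
  have hfa : ∀ r i, f (r, i) = (!r, i) := fun _ _ => rfl
  have hf : ∀ x y, ladder.Adj x y ↔ ladder.Adj (f x) (f y) := by
    rintro ⟨r, i⟩ ⟨s, j⟩
    rw [hfa, hfa]
    cases r <;> cases s <;> simp [ladder_adj]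
  rw [regionTrees, ← ncard_treesOn_image f hf (region a b), regionTrees]
  congr
  ext ⟨r, i⟩
  cases r <;> simp [hfa]

theorem ncard_treesOn_translate (a b c : ℕ) :
    (treesOn ladder ((fun p : Bool × ℤ => (p.1, p.2 + c)) '' region a b)).ncard =
      regionTrees a b := by
  refine ncard_treesOn_image ⟨fun p : Bool × ℤ => (p.1, p.2 + c), ?_⟩ ?_ (region a b)
  · rintro ⟨r, i⟩ ⟨s, j⟩ h
    simpa using h
  · rintro ⟨r, i⟩ ⟨s, j⟩
    change _ ↔ ladder.Adj (r, i + c) (s, j + c)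
    cases r <;> cases s <;> simp [ladder_adj] <;> omega

theorem ncard_treesOn_sdiff_left {n a : ℕ} (ha : a ≤ n) :
    (treesOn ladder (region n n \ region a n)).ncard = regionTrees (n - a) 0 := by
  rw [← ncard_treesOn_translate _ _ a]
  congr
  ext ⟨r, i⟩
  simp only [Set.mem_sdiff, Set.mem_image, Prod.exists, Prod.mk.injEq]
  constructor
  · intro h
    refine ⟨r, i - a, ?_, rfl, by omega⟩
    cases r <;> simp at h ⊢ <;> omega
  · rintro ⟨s, j, h, rfl, rfl⟩
    cases s <;> simp at h ⊢ <;> omega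

theorem ncard_treesOn_sdiff_right {n b : ℕ} (hb : b ≤ n) :
    (treesOn ladder (region n n \ region n b)).ncard = regionTrees 0 (n - b) := by
  rw [← ncard_treesOn_translate _ _ b]
  congr
  ext ⟨r, i⟩
  simp only [Set.mem_sdiff, Set.mem_image, Prod.exists, Prod.mk.injEq]
  constructor
  · intro h
    refine ⟨r, i - b, ?_, rfl, by omega⟩
    cases r <;> simp at h ⊢ <;> omega
  · rintro ⟨s, j, h, rfl, rfl⟩
    cases s <;> simp at h ⊢ <;> omega

/-- The half turn of the grid, which swaps the rows and sends column i to n - 1 - i, exchanges the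
region and its complement. -/
theorem ncard_treesOn_complement {n k : ℕ} (hk : k ≤ n) :
    (treesOn ladder (region n n \ region k (n - k))).ncard = regionTrees k (n - k) := by
  let f : Bool × ℤ ↪ Bool × ℤ := ⟨fun p => (!p.1, n - 1 - p.2), by
    rintro ⟨r, i⟩ ⟨s, j⟩ h
    simpa using h⟩
  have hfa : ∀ r i, f (r, i) = (!r, n - 1 - i) := fun _ _ => rfl
  have hf : ∀ x y, ladder.Adj x y ↔ ladder.Adj (f x) (f y) := by
    rintro ⟨r, i⟩ ⟨s, j⟩
    rw [hfa, hfa]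
    cases r <;> cases s <;> simp [ladder_adj] <;> omega
  rw [regionTrees, ← ncard_treesOn_image f hf (region k (n - k))]
  congr
  ext ⟨r, i⟩
  simp only [Set.mem_sdiff, Set.mem_image, Prod.exists, hfa, Prod.mk.injEq]
  constructor
  · intro h
    refine ⟨!r, n - 1 - i, ?_, by simp, by omega⟩
    cases r <;> simp at h ⊢ <;> omega
  · rintro ⟨s, j, h, rfl, rfl⟩
    cases s <;> simp at h ⊢ <;> omega

/-! ### Trees on a region depend only on its shorter row -/

theorem region_succ_left (a b : ℕ) : region (a + 1) b = insert (false, (a : ℤ)) (region a b) := by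
  ext ⟨r, i⟩
  cases r <;> simp <;> omega

theorem region_succ_right (a b : ℕ) : region a (b + 1) = insert (true, (b : ℤ)) (region a b) := by
  ext ⟨r, i⟩
  cases r <;> simp <;> omega

/-- Since b ≤ a, the new vertex has no rung within the region, so it is a leaf attached to its
predecessor in the row. -/
theorem regionTrees_succ_left {a b : ℕ} (hba : b ≤ a) (ha : 1 ≤ a) :
    regionTrees (a + 1) b = regionTrees a b := by
  rw [regionTrees, region_succ_left]
  refine ncard_treesOn_insert (u := (false, (a : ℤ) - 1)) ?_ ?_ ?_ ?_
  · simp; omega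
  · simp
  · simp [ladder_adj]
  · rintro ⟨r, i⟩ hx h
    cases r <;> simp [ladder_adj] at hx h ⊢ <;> omega

theorem regionTrees_one_zero : regionTrees 1 0 = 1 := by
  have : region 1 0 = {(false, 0)} := by
    ext ⟨r, i⟩
    cases r <;> simp <;> omega
  rw [regionTrees, this, ncard_treesOn_singleton]

theorem regionTrees_one_one : regionTrees 1 1 = 1 := by
  refine Eq.trans ?_ regionTrees_one_zero
  rw [regionTrees, region_succ_right 1 0, regionTrees]
  refine ncard_treesOn_insert (u := (false, 0)) (by simp) (by simp) (by simp [ladder_adj]) ?_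
  rintro ⟨r, i⟩ hx h
  cases r <;> simp [ladder_adj] at hx h ⊢ <;> omega

/-- A tree is required to be nonempty. The resulting value T 0 = 0 lets the linear recurrence start
at 0. -/
theorem regionTrees_zero_zero : regionTrees 0 0 = 0 := by
  rw [regionTrees, Set.ncard_eq_zero (finite_treesOn _ (finite_region _ _)),
    Set.eq_empty_iff_forall_notMem]
  rintro H ⟨-, hH⟩
  obtain ⟨⟨r, i⟩, h⟩ := hH.nonempty
  cases r <;> simp at h <;> omega

theorem regionTrees_zero_right {a : ℕ} (ha : 1 ≤ a) : regionTrees a 0 = 1 := by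
  induction a, ha using Nat.le_induction with
  | base => exact regionTrees_one_zero
  | succ a ha ih => rw [regionTrees_succ_left (Nat.zero_le _) ha, ih]

theorem regionTrees_of_le {a b : ℕ} (hb : 1 ≤ b) (hba : b ≤ a) : regionTrees a b = T b := by
  rw [T_eq_regionTrees]
  induction a, hba using Nat.le_induction with
  | base => rfl
  | succ a ha ih => rw [regionTrees_succ_left ha (hb.trans ha), ih]

/-! ### Connected bipartitions of a grid -/

/-- A set of vertices of the ladder that has an edge along the ladder between any two
consecutive columns that separate it. -/
def CrossesGaps (X : Set (Bool × ℤ)) : Prop :=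
  ∀ ⦃p⦄, p ∈ X → ∀ ⦃q⦄, q ∈ X → ∀ ⦃c : ℤ⦄, p.2 ≤ c → c + 1 ≤ q.2 → ∃ r, (r, c) ∈ X ∧ (r, c + 1) ∈ X

/-- Rungs stay in one column, so an edge leaving the columns up to c is horizontal. This consequence
of connectedness is all that the classification of bipartitions uses. -/
theorem IsTreeOn.crossesGaps {H : SimpleGraph (Bool × ℤ)} {X : Set (Bool × ℤ)} (hle : H ≤ ladder)
    (hH : IsTreeOn H X) : CrossesGaps X := by
  intro p hp q hq c hpc hcq
  obtain ⟨⟨r, i⟩, ⟨s, j⟩, hadj, ha, hb⟩ := exists_adj_of_reachable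
    (X := {p : Bool × ℤ | p.2 ≤ c}) (hH.reachable hp hq) hpc (by simp; omega)
  have h1 := hH.mem_of_adj hadj
  have h2 := hH.mem_of_adj hadj.symm
  have h3 := ladder_adj.1 (hle hadj)
  simp only [Set.mem_ofPred_eq, not_le] at ha hb h3
  obtain ⟨rfl, hij⟩ : r = s ∧ i + 1 = j := by
    rcases h3 with h3 | ⟨h3, h4⟩
    · omega
    · exact ⟨h3, by omega⟩
  have hi : i = c := by omega
  subst hi hij
  exact ⟨r, h1, h2⟩

theorem crossesGaps_of_joinedTrees {H : SimpleGraph (Bool × ℤ)} {A B : Set (Bool × ℤ)}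
    {u v : Bool × ℤ} (hu : u ∈ A) (hv : v ∈ B) (hH : H ∈ joinedTrees ladder A B u v) :
    CrossesGaps A ∧ CrossesGaps B :=
  ⟨(isTreeOn_restrict hu hH).crossesGaps ((restrict_le _ _).trans hH.1),
    (isTreeOn_restrict hv ((joinedTrees_symm _ _ _ _ _).subset hH)).crossesGaps
      ((restrict_le _ _).trans hH.1)⟩

/-- The connected bipartitions of a grid separating the two vertices of the last column. -/
theorem region_of_separates_last {n : ℕ} {A B : Set (Bool × ℤ)} (hAB : Disjoint A B)
    (hC : A ∪ B = region (n + 1) (n + 1)) (hA : CrossesGaps A) (hB : CrossesGaps B)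
    (hu : (false, (n : ℤ)) ∈ A) (hv : (true, (n : ℤ)) ∈ B) :
    (∃ a ∈ Finset.range (n + 1), B = region a (n + 1)) ∨
      ∃ b ∈ Finset.Icc 1 n, A = region (n + 1) b := by
  classical
  have hd : ∀ p, p ∈ A → p ∉ B := fun p hp => Set.disjoint_left.1 hAB hp
  have hmem : ∀ r i, (r, i) ∈ A ∨ (r, i) ∈ B ↔ 0 ≤ i ∧ i < n + 1 := by
    intro r i
    rw [← Set.mem_union, hC]
    cases r <;> simp
  by_cases h1 : ∃ c, (true, c) ∈ A
  · by_cases h2 : ∃ d, (false, d) ∈ B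
    · exfalso
      obtain ⟨c, hc⟩ := h1
      obtain ⟨d, hd'⟩ := h2
      -- Moving left from the last column, A and B must both cross each gap. Each is therefore kept
      -- in its own row as far as column max c d, where one of them meets a vertex of the other.
      have key : ∀ k : ℕ, max c d ≤ n - k → (false, (n : ℤ) - k) ∈ A ∧ (true, (n : ℤ) - k) ∈ B := by
        intro k
        induction k with
        | zero => intro _; simpa using ⟨hu, hv⟩
        | succ k ih =>
          intro hk
          push_cast at hk ⊢
          obtain ⟨ih1, ih2⟩ := ih (by omega)
          have e : (n : ℤ) - (k + 1) + 1 = n - k := by ring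
          obtain ⟨r, hr, hr'⟩ := hA hc hu (c := (n : ℤ) - (k + 1)) (by simp; omega) (by simp)
          obtain ⟨s, hs, hs'⟩ := hB hd' hv (c := (n : ℤ) - (k + 1)) (by simp; omega)
            (by simp)
          rw [e] at hr' hs'
          have hr0 : r = false := by
            cases r
            · rfl
            · exact absurd ih2 (hd _ hr')
          have hs0 : s = true := by
            cases s
            · exact absurd hs' (hd _ ih1)
            · rfl
          subst hr0 hs0
          exact ⟨hr, hs⟩
      have hc' := (hmem _ _).1 (Or.inl hc)
      have hd'' := (hmem _ _).1 (Or.inr hd')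
      obtain ⟨k1, k2⟩ := key (n - max c d).toNat (by omega)
      have e : (n : ℤ) - (n - max c d).toNat = max c d := by omega
      rw [e] at k1 k2
      rcases le_total c d with h | h
      · rw [max_eq_right h] at k1
        exact hd _ k1 hd'
      · rw [max_eq_left h] at k2
        exact hd _ hc k2
    · right
      push Not at h2
      -- Here B lies in the row `true`, and connectedness makes it a final segment, starting at the
      -- least column it contains. That column is at least 1 because A also meets this row; the
      -- partition into two full rows is left to the other alternative, with a = 0.
      have hex : ∃ b : ℕ, (true, (b : ℤ)) ∈ B := ⟨n, hv⟩
      obtain ⟨c, hc⟩ := h1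
      have hmin : ∀ i : ℤ, (true, i) ∈ B ↔ (Nat.find hex : ℤ) ≤ i ∧ i < n + 1 := by
        intro i
        constructor
        · intro hi
          have := (hmem _ _).1 (Or.inr hi)
          have h3 : Nat.find hex ≤ i.toNat := Nat.find_min' hex (by rwa [Int.toNat_of_nonneg this.1])
          omega
        · rintro ⟨h3, h4⟩
          rcases eq_or_lt_of_le (Int.lt_add_one_iff.1 h4) with rfl | h5
          · exact hv
          · obtain ⟨r, hr, -⟩ := hB (Nat.find_spec hex) hv h3 (by simp; omega)
            cases r
            · exact absurd hr (h2 _)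
            · exact hr
      have hb := (hmin n).1 hv
      have hc' := (hmem _ _).1 (Or.inl hc)
      have hc'' := mt (hmin c).2 (hd _ hc)
      refine ⟨Nat.find hex, by simp only [Finset.mem_Icc]; omega, ?_⟩
      ext ⟨r, i⟩
      have e1 := hmem r i
      have e2 := hd (r, i)
      cases r
      · have := h2 i
        rw [mem_region_false]
        push_cast
        tauto
      · have := hmin i
        rw [mem_region_true]
        constructor
        · intro h
          have h6 := e1.1 (Or.inl h)
          have h7 := mt this.2 (e2 h)
          omega
        · intro h
          rcases e1.2 ⟨h.1, by omega⟩ with h6 | h6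
          · exact h6
          · have := this.1 h6
            omega
  · left
    push Not at h1
    have hex : ∃ a : ℕ, (false, (a : ℤ)) ∈ A := ⟨n, hu⟩
    have hmin : ∀ i : ℤ, (false, i) ∈ A ↔ (Nat.find hex : ℤ) ≤ i ∧ i < n + 1 := by
      intro i
      constructor
      · intro hi
        have := (hmem _ _).1 (Or.inl hi)
        have h3 : Nat.find hex ≤ i.toNat := Nat.find_min' hex (by rwa [Int.toNat_of_nonneg this.1])
        omega
      · rintro ⟨h3, h4⟩
        rcases eq_or_lt_of_le (Int.lt_add_one_iff.1 h4) with rfl | h5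
        · exact hu
        · obtain ⟨r, hr, -⟩ := hA (Nat.find_spec hex) hu h3 (by simp; omega)
          cases r
          · exact hr
          · exact absurd hr (h1 _)
    have hb := (hmin n).1 hu
    refine ⟨Nat.find hex, by simp only [Finset.mem_range]; omega, ?_⟩
    ext ⟨r, i⟩
    have e1 := hmem r i
    have e2 := hd (r, i)
    cases r
    · have := hmin i
      rw [mem_region_false]
      constructor
      · intro h
        have h6 := e1.1 (Or.inr h)
        have h7 := mt this.2 (fun h' => e2 h' h)
        omega
      · intro h
        rcases e1.2 ⟨h.1, by omega⟩ with h6 | h6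
        · have := this.1 h6
          omega
        · exact h6
    · have := h1 i
      rw [mem_region_true]
      push_cast
      tauto

/-- The connected bipartitions of a grid into halves of equal size. -/
theorem region_of_balanced {n : ℕ} {A B : Set (Bool × ℤ)} (hAB : Disjoint A B)
    (hC : A ∪ B = region n n) (hA : CrossesGaps A) (hB : CrossesGaps B)
    (hw : (true, 0) ∈ A) (hcard : A.ncard = B.ncard) :
    ∃ k ∈ Finset.range n, A = region k (n - k) := by
  classical
  have hd : ∀ p, p ∈ A → p ∉ B := fun p hp => Set.disjoint_left.1 hAB hp
  have hmem : ∀ r i, (r, i) ∈ A ∨ (r, i) ∈ B ↔ 0 ≤ i ∧ i < n := by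
    intro r i
    rw [← Set.mem_union, hC]
    cases r <;> simp
  have hAfin : A.Finite := (finite_region n n).subset (hC ▸ Set.subset_union_left)
  have hBfin : B.Finite := (finite_region n n).subset (hC ▸ Set.subset_union_right)
  -- A is an initial segment of each row. Suppose instead that (r, c) is in B. Then A crosses gap c
  -- in the other row, so B cannot cross it and stays in columns up to c. A meets each of these
  -- columns, since it contains the corner, so swapping the rows maps B into A. The image misses (r,
  -- c + 1), hence B is smaller than A, a contradiction.
  have hstep : ∀ r (c : ℤ), 0 ≤ c → (r, c + 1) ∈ A → (r, c) ∈ A := by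
    intro r c hc hr
    by_contra hrc
    have hrB : (r, c) ∈ B :=
      ((hmem r c).2 ⟨hc, by have := (hmem r (c + 1)).1 (Or.inl hr); omega⟩).resolve_left hrc
    obtain ⟨s, hs, hs'⟩ := hA hw hr hc le_rfl
    have hsr : s = !r := by
      cases s <;> cases r <;> simp_all
    subst hsr
    have hleft : ∀ p ∈ B, p.2 ≤ c := by
      intro p hp
      by_contra! hpc
      obtain ⟨t, ht, ht'⟩ := hB hrB hp le_rfl (by omega)
      rcases Bool.eq_or_eq_not t r with rfl | rfl
      · exact hd _ hr ht'
      · exact hd _ hs ht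
    have hinj : Function.Injective (fun p : Bool × ℤ => (!p.1, p.2)) := by
      rintro ⟨r, i⟩ ⟨s, j⟩ h
      simpa using h
    have hsub : (fun p : Bool × ℤ => (!p.1, p.2)) '' B ⊂ A := by
      refine (Set.ssubset_iff_of_subset ?_).2 ⟨(r, c + 1), hr, ?_⟩
      · rintro _ ⟨⟨t, i⟩, hp, rfl⟩
        have hi := hleft _ hp
        have hi' := (hmem _ _).1 (Or.inr hp)
        obtain ⟨t', ht', -⟩ := hA hw hr (c := i) hi'.1 (by simpa using hi)
        rcases Bool.eq_or_eq_not t' t with rfl | rfl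
        · exact absurd hp (hd _ ht')
        · exact ht'
      · rintro ⟨⟨t, i⟩, hp, he⟩
        have hi := hleft _ hp
        simp only [Prod.mk.injEq] at he hi
        omega
    have := Set.ncard_lt_ncard hsub hAfin
    rw [Set.ncard_image_of_injective _ hinj] at this
    omega
  have hrow : ∀ r, ∃ a : ℕ, ∀ i : ℤ, (r, i) ∈ A ↔ 0 ≤ i ∧ i < a := by
    intro r
    have hex : ∃ a : ℕ, (r, (a : ℤ)) ∉ A := ⟨n, fun h => by
      have := (hmem _ _).1 (Or.inl h)
      omega⟩
    refine ⟨Nat.find hex, fun i => ⟨fun hi => ?_, fun hi => ?_⟩⟩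
    · have h0 := (hmem _ _).1 (Or.inl hi)
      refine ⟨h0.1, ?_⟩
      by_contra! hle
      have key : ∀ j : ℕ, (r, (Nat.find hex : ℤ) + j) ∉ A := by
        intro j
        induction j with
        | zero => simpa using Nat.find_spec hex
        | succ j ih =>
          intro h
          refine ih (hstep r _ (by omega) ?_)
          rw [add_assoc]
          exact_mod_cast h
      refine key (i - Nat.find hex).toNat ?_
      rwa [Int.toNat_of_nonneg (by omega), add_sub_cancel]
    · have := Nat.find_min hex (m := i.toNat) (by omega)
      rwa [not_not, Int.toNat_of_nonneg hi.1] at this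
  obtain ⟨a, ha⟩ := hrow false
  obtain ⟨b, hb⟩ := hrow true
  have hAeq : A = region a b := by
    ext ⟨r, i⟩
    cases r
    · rw [ha, mem_region_false]
    · rw [hb, mem_region_true]
  have h1 := Set.ncard_union_eq hAB hAfin hBfin
  rw [hC, ← hcard, hAeq, ncard_region, ncard_region] at h1
  have h2 := (hb 0).1 hw
  refine ⟨a, by simp only [Finset.mem_range]; omega, ?_⟩
  rw [hAeq, show n - a = b by omega]

/-! ### The recurrence for the number of spanning trees -/

/-- Without the last rung both vertices of the last column are leaves, and are stripped one after
the other. The remaining region does not contain that rung, so its deletion no longer matters. -/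
theorem ncard_treesOn_without_last_rung {n : ℕ} (hn : 1 ≤ n) :
    (treesOn (ladder.deleteEdges {s((false, (n : ℤ)), (true, (n : ℤ)))})
      (region (n + 1) (n + 1))).ncard = T n := by
  set L := ladder.deleteEdges {s((false, (n : ℤ)), (true, (n : ℤ)))} with hL
  have hadj : ∀ p q, L.Adj p q ↔ ladder.Adj p q ∧
      ¬ (p = (false, (n : ℤ)) ∧ q = (true, (n : ℤ)) ∨ p = (true, (n : ℤ)) ∧ q = (false, (n : ℤ))) := by
    intro p q
    rw [hL, deleteEdges_adj, Set.mem_singleton_iff, Sym2.eq_iff]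
  have h1 : (treesOn L (region (n + 1) (n + 1))).ncard = (treesOn L (region n (n + 1))).ncard := by
    rw [region_succ_left]
    refine ncard_treesOn_insert (u := (false, (n : ℤ) - 1)) ?_ ?_ ?_ ?_
    · simp; omega
    · simp
    · simp [hadj, ladder_adj]
    · rintro ⟨r, i⟩ hx h
      rw [hadj, ladder_adj] at h
      cases r <;> simp at hx h ⊢ <;> omega
  have h2 : (treesOn L (region n (n + 1))).ncard = (treesOn L (region n n)).ncard := by
    rw [region_succ_right]
    refine ncard_treesOn_insert (u := (true, (n : ℤ) - 1)) ?_ ?_ ?_ ?_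
    · simp; omega
    · simp
    · simp [hadj, ladder_adj]
    · rintro ⟨r, i⟩ hx h
      rw [hadj, ladder_adj] at h
      cases r <;> simp at hx h ⊢ <;> omega
  rw [h1, h2, T_eq_regionTrees, regionTrees]
  congr 1
  ext H
  refine ⟨fun h => ⟨h.1.trans (deleteEdges_le _), h.2⟩, fun h => ⟨fun p q hpq => ?_, h.2⟩⟩
  rw [hadj]
  refine ⟨h.1 hpq, ?_⟩
  have hp := h.2.mem_of_adj hpq
  rintro (⟨rfl, rfl⟩ | ⟨rfl, rfl⟩) <;> simp at hp

theorem regionTrees_of_ge {a b : ℕ} (ha : 1 ≤ a) (hab : a ≤ b) : regionTrees a b = T a := by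
  rw [regionTrees_symm, regionTrees_of_le ha hab]

/-- T n counts the trees without the last rung. The others are sorted by the cut at that rung: `F a`
and `G b` are the families where a final segment of the first or of the second row is split off. The
segment carries one tree and the rest T a or T b. The term 1 is the case a = 0, where the two sides
are the full rows. -/
theorem T_succ {n : ℕ} (hn : 1 ≤ n) : T (n + 1) = T n + 1 + 2 * ∑ b ∈ Finset.Icc 1 n, T b := by
  set C := region (n + 1) (n + 1) with hCdef
  set u : Bool × ℤ := (false, (n : ℤ)) with hu
  set v : Bool × ℤ := (true, (n : ℤ)) with hv
  have huv : ladder.Adj u v := by simp [ladder_adj, hu, hv]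
  have hCfin : C.Finite := finite_region _ _
  have hsub : ∀ a b, a ≤ n + 1 → b ≤ n + 1 → region a b ⊆ C := by
    rintro a b ha hb ⟨r, i⟩ h
    cases r <;> simp [hCdef] at h ⊢ <;> omega
  let F : ℕ → Set (SimpleGraph (Bool × ℤ)) := fun a =>
    joinedTrees ladder (C \ region a (n + 1)) (region a (n + 1)) u v
  let G : ℕ → Set (SimpleGraph (Bool × ℤ)) := fun b =>
    joinedTrees ladder (region (n + 1) b) (C \ region (n + 1) b) u v
  have hFsub : ∀ a ∈ Finset.range (n + 1), F a ⊆ treesOn ladder C := by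
    intro a ha
    rw [Finset.mem_range] at ha
    have := joinedTrees_subset_treesOn ladder (C \ region a (n + 1)) (region a (n + 1)) u v
    rwa [Set.sdiff_union_of_subset (hsub _ _ ha.le le_rfl)] at this
  have hGsub : ∀ b ∈ Finset.Icc 1 n, G b ⊆ treesOn ladder C := by
    intro b hb
    rw [Finset.mem_Icc] at hb
    have := joinedTrees_subset_treesOn ladder (region (n + 1) b) (C \ region (n + 1) b) u v
    rwa [Set.union_sdiff_cancel (hsub _ _ le_rfl (by omega))] at this
  have huF : ∀ a ∈ Finset.range (n + 1), u ∈ C \ region a (n + 1) ∧ v ∈ region a (n + 1) := by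
    intro a ha
    rw [Finset.mem_range] at ha
    simp [hCdef, hu, hv]; omega
  have huG : ∀ b ∈ Finset.Icc 1 n, u ∈ region (n + 1) b ∧ v ∈ C \ region (n + 1) b := by
    intro b hb
    rw [Finset.mem_Icc] at hb
    simp [hCdef, hu, hv]; omega
  have hFfin : ∀ a ∈ Finset.range (n + 1), (F a).Finite :=
    fun a ha => (finite_treesOn _ hCfin).subset (hFsub a ha)
  have hGfin : ∀ b ∈ Finset.Icc 1 n, (G b).Finite :=
    fun b hb => (finite_treesOn _ hCfin).subset (hGsub b hb)
  have hsplit : treesOn ladder C = treesOn (ladder.deleteEdges {s(u, v)}) C ∪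
      ((⋃ a ∈ Finset.range (n + 1), F a) ∪ ⋃ b ∈ Finset.Icc 1 n, G b) := by
    ext H
    constructor
    · intro hH
      by_cases h : H.Adj u v
      · right
        obtain ⟨A, B, hAB, hABC, huA, hvB, hJ⟩ := exists_mem_joinedTrees hH h
        obtain ⟨hA, hB⟩ := crossesGaps_of_joinedTrees huA hvB hJ
        rcases region_of_separates_last hAB hABC hA hB huA hvB with ⟨a, ha, rfl⟩ | ⟨b, hb, rfl⟩
        · left
          have : A = C \ region a (n + 1) := by
            rw [← hABC, Set.union_sdiff_cancel_right hAB.le_bot]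
          rw [this] at hJ
          exact Set.mem_biUnion ha hJ
        · right
          have : B = C \ region (n + 1) b := by
            rw [← hABC, Set.union_sdiff_cancel_left hAB.le_bot]
          rw [this] at hJ
          exact Set.mem_biUnion hb hJ
      · left
        refine ⟨fun p q hpq => ?_, hH.2⟩
        rw [deleteEdges_adj, Set.mem_singleton_iff, Sym2.eq_iff]
        refine ⟨hH.1 hpq, ?_⟩
        rintro (⟨rfl, rfl⟩ | ⟨rfl, rfl⟩)
        exacts [h hpq, h hpq.symm]
    · rintro (hH | hH | hH)
      · exact ⟨hH.1.trans (deleteEdges_le _), hH.2⟩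
      · obtain ⟨a, ha, hH⟩ := Set.mem_iUnion₂.1 hH
        exact hFsub a ha hH
      · obtain ⟨b, hb, hH⟩ := Set.mem_iUnion₂.1 hH
        exact hGsub b hb hH
  have hadjFG : ∀ H ∈ (⋃ a ∈ Finset.range (n + 1), F a) ∪ ⋃ b ∈ Finset.Icc 1 n, G b, H.Adj u v := by
    rintro H (hH | hH)
    · obtain ⟨a, ha, hH⟩ := Set.mem_iUnion₂.1 hH
      exact hH.2.2.1
    · obtain ⟨b, hb, hH⟩ := Set.mem_iUnion₂.1 hH
      exact hH.2.2.1
  have hd1 : Disjoint (treesOn (ladder.deleteEdges {s(u, v)}) C)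
      ((⋃ a ∈ Finset.range (n + 1), F a) ∪ ⋃ b ∈ Finset.Icc 1 n, G b) := by
    rw [Set.disjoint_left]
    intro H hH hH'
    have := hH.1 (hadjFG H hH')
    rw [deleteEdges_adj] at this
    exact this.2 rfl
  have hd2 : Disjoint (⋃ a ∈ Finset.range (n + 1), F a) (⋃ b ∈ Finset.Icc 1 n, G b) := by
    rw [Set.disjoint_left]
    intro H hH hH'
    obtain ⟨a, ha, hH⟩ := Set.mem_iUnion₂.1 hH
    obtain ⟨b, hb, hH'⟩ := Set.mem_iUnion₂.1 hH'
    have := joinedTrees_side_unique Set.disjoint_sdiff_left Set.disjoint_sdiff_right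
      (huF a ha).1 (huF a ha).2 (huG b hb).1 (huG b hb).2 hH hH'
    -- The corner (true, 0) is on the side of u in the family `G`, because b ≥ 1, but never in the
    -- family `F`.
    have h0 : ((true, 0) : Bool × ℤ) ∈ region (n + 1) b := by
      rw [Finset.mem_Icc] at hb
      simp; omega
    rw [← this] at h0
    refine h0.2 ?_
    simp
  have hdF : ∀ a ∈ Finset.range (n + 1), ∀ a' ∈ Finset.range (n + 1), a ≠ a' →
      Disjoint (F a) (F a') := by
    intro a ha a' ha' hne
    rw [Set.disjoint_left]
    intro H hH hH'
    have := joinedTrees_side_unique Set.disjoint_sdiff_left Set.disjoint_sdiff_left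
      (huF a ha).1 (huF a ha).2 (huF a' ha').1 (huF a' ha').2 hH hH'
    rw [Finset.mem_range] at ha ha'
    have h1 := Set.ext_iff.1 this (false, (a : ℤ))
    have h2 := Set.ext_iff.1 this (false, (a' : ℤ))
    simp [hCdef] at h1 h2
    omega
  have hdG : ∀ b ∈ Finset.Icc 1 n, ∀ b' ∈ Finset.Icc 1 n, b ≠ b' → Disjoint (G b) (G b') := by
    intro b hb b' hb' hne
    rw [Set.disjoint_left]
    intro H hH hH'
    have := joinedTrees_side_unique Set.disjoint_sdiff_right Set.disjoint_sdiff_right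
      (huG b hb).1 (huG b hb).2 (huG b' hb').1 (huG b' hb').2 hH hH'
    have := congrArg Set.ncard this
    rw [ncard_region, ncard_region] at this
    omega
  have hF : ∀ a ∈ Finset.range (n + 1), (F a).ncard = regionTrees a (n + 1) := by
    intro a ha
    rw [ncard_joinedTrees Set.disjoint_sdiff_left (huF a ha).1 (huF a ha).2 huv]
    rw [Finset.mem_range] at ha
    rw [hCdef, ncard_treesOn_sdiff_left ha.le, regionTrees_zero_right (by omega), one_mul,
      regionTrees]
  have hG : ∀ b ∈ Finset.Icc 1 n, (G b).ncard = T b := by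
    intro b hb
    rw [ncard_joinedTrees Set.disjoint_sdiff_right (huG b hb).1 (huG b hb).2 huv]
    rw [Finset.mem_Icc] at hb
    rw [hCdef, ncard_treesOn_sdiff_right (by omega), regionTrees_symm 0,
      regionTrees_zero_right (by omega), mul_one]
    exact regionTrees_of_le hb.1 (by omega)
  have hFU : (⋃ a ∈ Finset.range (n + 1), F a).Finite :=
    (finite_treesOn _ hCfin).subset (Set.iUnion₂_subset hFsub)
  have hGU : (⋃ b ∈ Finset.Icc 1 n, G b).Finite :=
    (finite_treesOn _ hCfin).subset (Set.iUnion₂_subset hGsub)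
  rw [T_eq_regionTrees, regionTrees, ← hCdef, hsplit, Set.ncard_union_eq hd1 (finite_treesOn _ hCfin)
    (hFU.union hGU),
    Set.ncard_union_eq hd2 hFU hGU, ncard_biUnion_finset _ _ hFfin hdF, ncard_biUnion_finset _ _ hGfin hdG,
    Finset.sum_congr rfl hF, Finset.sum_congr rfl hG, ncard_treesOn_without_last_rung hn,
    Finset.sum_range_succ', regionTrees_symm, regionTrees_zero_right (by omega)]
  have : ∑ k ∈ Finset.range n, regionTrees (k + 1) (n + 1) = ∑ b ∈ Finset.Icc 1 n, T b := by
    rw [Finset.range_eq_Ico, Finset.sum_Ico_add' (fun k => regionTrees k (n + 1))]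
    refine Finset.sum_congr (by ext; simp) fun k hk => ?_
    rw [Finset.mem_Icc] at hk
    exact regionTrees_of_ge hk.1 (by omega)
  rw [this]
  ring

theorem T_zero : T 0 = 0 := by rw [T_eq_regionTrees, regionTrees_zero_zero]

theorem T_one : T 1 = 1 := by rw [T_eq_regionTrees, regionTrees_one_one]

/-- Subtracting two consecutive instances of `T_succ` eliminates the sum. -/
theorem T_add_two (n : ℕ) : T (n + 2) + T n = 4 * T (n + 1) := by
  have h1 : T (n + 2) = _ := T_succ (n := n + 1) (by omega)
  rw [Finset.sum_Icc_succ_top (by omega)] at h1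
  rcases Nat.eq_zero_or_pos n with rfl | hn
  · simp [T_one, T_zero] at h1 ⊢
    omega
  · have h2 := T_succ hn
    omega

/-! ### Balanced cuts and the number of balanced trees -/

/-- The edges of the grid between a region of half its size and the complement. -/
def cutEdges (n k : ℕ) : Set ((Bool × ℤ) × (Bool × ℤ)) :=
  {p | p.1 ∈ region k (n - k) ∧ p.2 ∈ region n n \ region k (n - k) ∧ ladder.Adj p.1 p.2}

/-- The rung in column `i`, directed from the region `region k (n - k)` to its complement. -/
def cutRung (k : ℕ) (i : ℤ) : (Bool × ℤ) × (Bool × ℤ) :=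
  ((decide ((k : ℤ) ≤ i), i), (!decide ((k : ℤ) ≤ i), i))

theorem cutRung_injective (k : ℕ) : Function.Injective (cutRung k) := by
  intro i j h
  simp only [cutRung, Prod.mk.injEq] at h
  exact h.1.2

theorem cutRung_mem_cutEdges {n k : ℕ} (hk : k < n) {i : ℤ} (h1 : (min k (n - k) : ℕ) ≤ i)
    (h2 : i < (max k (n - k) : ℕ)) : cutRung k i ∈ cutEdges n k := by
  by_cases h : (k : ℤ) ≤ i <;> simp [cutEdges, cutRung, h, ladder_adj] <;> omega

/-- In the columns between the two row lengths of the region, the rung joins the halves. The only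
other crossing edges are the horizontal ones at the end of each row segment; there are none for k =
0, where each half is a full row. -/
theorem mem_cutEdges_cases {n k : ℕ} (hk : k < n) {p : (Bool × ℤ) × (Bool × ℤ)}
    (hp : p ∈ cutEdges n k) :
    (∃ i : ℤ, ((min k (n - k) : ℕ) ≤ i ∧ i < (max k (n - k) : ℕ)) ∧ cutRung k i = p) ∨
      (1 ≤ k ∧ (p = ((false, (k : ℤ) - 1), (false, (k : ℤ))) ∨
        p = ((true, (n : ℤ) - k - 1), (true, (n : ℤ) - k)))) := by
  obtain ⟨⟨r, i⟩, ⟨s, j⟩⟩ := p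
  obtain ⟨h1, h2, h3⟩ := hp
  simp only [ladder_adj] at h3
  by_cases hki : (k : ℤ) ≤ i <;> cases r <;> cases s <;> simp [cutRung, hki] at h1 h2 h3 ⊢ <;> omega

theorem ncard_cutEdges_zero {n : ℕ} (hn : 1 ≤ n) : (cutEdges n 0).ncard = n := by
  have : cutEdges n 0 = cutRung 0 '' (Finset.Ico (0 : ℤ) n : Set ℤ) := by
    ext p
    constructor
    · intro hp
      rcases mem_cutEdges_cases hn hp with ⟨i, hi, rfl⟩ | h
      · exact ⟨i, by simpa using hi, rfl⟩
      · omega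
    · rintro ⟨i, hi, rfl⟩
      rw [Finset.coe_Ico, Set.mem_Ico] at hi
      exact cutRung_mem_cutEdges hn (by simpa using hi.1) (by simpa using hi.2)
  rw [this, Set.ncard_image_of_injective _ (cutRung_injective _), Set.ncard_coe_finset]
  simp

theorem ncard_cutEdges {n k : ℕ} (hk : 1 ≤ k) (hkn : k < n) :
    (cutEdges n k).ncard = max k (n - k) - min k (n - k) + 2 := by
  have : cutEdges n k =
      cutRung k '' (Finset.Ico ((min k (n - k) : ℕ) : ℤ) (max k (n - k) : ℕ) : Set ℤ) ∪
      {((false, (k : ℤ) - 1), (false, (k : ℤ))), ((true, (n : ℤ) - k - 1), (true, (n : ℤ) - k))} := by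
    ext p
    constructor
    · intro hp
      rcases mem_cutEdges_cases hkn hp with ⟨i, hi, rfl⟩ | h
      · exact Or.inl ⟨i, by rwa [Finset.coe_Ico, Set.mem_Ico], rfl⟩
      · exact Or.inr h.2
    · rintro (⟨i, hi, rfl⟩ | rfl | rfl)
      · rw [Finset.coe_Ico, Set.mem_Ico] at hi
        exact cutRung_mem_cutEdges hkn hi.1 hi.2
      · simp [cutEdges, ladder_adj]; omega
      · simp [cutEdges, ladder_adj]; omega
  rw [this, Set.ncard_union_eq, Set.ncard_image_of_injective _ (cutRung_injective _),
    Set.ncard_coe_finset, Set.ncard_pair (by simp)]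
  · simp
    omega
  · rw [Set.disjoint_left]
    rintro _ ⟨i, -, rfl⟩ h
    simp [cutRung] at h
    omega

theorem finite_cutEdges (n k : ℕ) : (cutEdges n k).Finite :=
  ((finite_region k (n - k)).prod (finite_region n n)).subset fun _ hp => ⟨hp.1, hp.2.1.1⟩

theorem region_subset_region {n k : ℕ} (hk : k ≤ n) : region k (n - k) ⊆ region n n := by
  rintro ⟨r, i⟩ h
  cases r <;> simp at h ⊢ <;> omega

theorem ncard_region_sdiff {n k : ℕ} (hk : k ≤ n) :
    (region k (n - k)).ncard = (region n n \ region k (n - k)).ncard := by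
  rw [Set.ncard_sdiff (region_subset_region hk) (finite_region _ _), ncard_region, ncard_region]
  omega

theorem true_zero_mem_region {n k : ℕ} (hk : k < n) : ((true, 0) : Bool × ℤ) ∈ region k (n - k) := by
  simp; omega

/-- The trees on the grid cut into a region of half its size and the complement. -/
def halvedTrees (n k : ℕ) : Set (SimpleGraph (Bool × ℤ)) :=
  ⋃ p ∈ (finite_cutEdges n k).toFinset,
    joinedTrees ladder (region k (n - k)) (region n n \ region k (n - k)) p.1 p.2

theorem mem_halvedTrees {n k : ℕ} {H : SimpleGraph (Bool × ℤ)} : H ∈ halvedTrees n k ↔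
    ∃ u v, (u, v) ∈ cutEdges n k ∧
      H ∈ joinedTrees ladder (region k (n - k)) (region n n \ region k (n - k)) u v := by
  simp only [halvedTrees, Set.mem_iUnion, Set.Finite.mem_toFinset, exists_prop, Prod.exists]

theorem halvedTrees_subset {n k : ℕ} (hk : k ≤ n) : halvedTrees n k ⊆ treesOn ladder (region n n) := by
  intro H hH
  obtain ⟨u, v, -, hH⟩ := mem_halvedTrees.1 hH
  have := joinedTrees_subset_treesOn _ _ _ _ _ hH
  rwa [Set.union_sdiff_cancel (region_subset_region hk)] at this

theorem cut_unique {n k k' : ℕ} (hk : k < n) (hk' : k' < n) {H : SimpleGraph (Bool × ℤ)}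
    {u v u' v' : Bool × ℤ} (h : (u, v) ∈ cutEdges n k)
    (hH : H ∈ joinedTrees ladder (region k (n - k)) (region n n \ region k (n - k)) u v)
    (hH' : H ∈ joinedTrees ladder (region k' (n - k')) (region n n \ region k' (n - k')) u' v') :
    k = k' ∧ u = u' ∧ v = v' := by
  obtain ⟨h1, h2⟩ := joinedTrees_balanced_unique (finite_region n n) Set.disjoint_sdiff_right
    Set.disjoint_sdiff_right (Set.union_sdiff_cancel (region_subset_region hk.le))
    (Set.union_sdiff_cancel (region_subset_region hk'.le)) h.1 h.2.1 (ncard_region_sdiff hk.le)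
    (ncard_region_sdiff hk'.le) (true_zero_mem_region hk) (true_zero_mem_region hk') hH hH'
  refine ⟨?_, h2⟩
  have h3 := Set.ext_iff.1 h1 (false, (k : ℤ))
  have h4 := Set.ext_iff.1 h1 (false, (k' : ℤ))
  simp only [mem_region_false] at h3 h4
  omega

/-- Different cut edges give disjoint families by `cut_unique`, and for each edge the trees on the
two congruent halves are chosen independently. -/
theorem ncard_halvedTrees {n k : ℕ} (hk : k < n) :
    (halvedTrees n k).ncard = (cutEdges n k).ncard * regionTrees k (n - k) ^ 2 := by
  rw [halvedTrees, ncard_biUnion_finset]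
  · rw [Finset.sum_congr rfl (g := fun _ => regionTrees k (n - k) ^ 2), Finset.sum_const,
      smul_eq_mul, Set.ncard_eq_toFinset_card _ (finite_cutEdges n k)]
    rintro p hp
    rw [Set.Finite.mem_toFinset] at hp
    rw [ncard_joinedTrees Set.disjoint_sdiff_right hp.1 hp.2.1 hp.2.2,
      ncard_treesOn_complement hk.le, sq, regionTrees]
  · intro p hp
    refine (finite_treesOn ladder (finite_region n n)).subset ?_
    rintro H hH
    exact halvedTrees_subset hk.le (mem_halvedTrees.2 ⟨p.1, p.2, by simpa using hp, hH⟩)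
  · intro p hp q hq hne
    rw [Set.Finite.mem_toFinset] at hp
    rw [Set.disjoint_left]
    intro H hH hH'
    exact hne (Prod.ext_iff.2 (cut_unique hk hk hp hH hH').2)

theorem balancedTreesOn_region (n : ℕ) :
    balancedTreesOn ladder (region n n) = ⋃ k ∈ Finset.range n, halvedTrees n k := by
  ext H
  constructor
  · intro hH
    obtain ⟨A, B, u, v, hAB, hC, hu, hv, hcard, hJ, hw⟩ : ∃ (A B : Set (Bool × ℤ)) (u v : Bool × ℤ),
        Disjoint A B ∧ A ∪ B = region n n ∧ u ∈ A ∧ v ∈ B ∧ A.ncard = B.ncard ∧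
        H ∈ joinedTrees ladder A B u v ∧ (true, 0) ∈ A := by
      obtain ⟨A, B, u, v, hAB, hC, hu, hv, hcard, hJ⟩ := hH
      have hn : 0 < n := by
        have h : u ∈ region n n := hC ▸ Or.inl hu
        obtain ⟨r, i⟩ := u
        cases r <;> simp at h <;> omega
      have h0 : ((true, 0) : Bool × ℤ) ∈ A ∪ B := by
        rw [hC]
        simpa using hn
      rcases h0 with h0 | h0
      · exact ⟨A, B, u, v, hAB, hC, hu, hv, hcard, hJ, h0⟩
      · exact ⟨B, A, v, u, hAB.symm, by rw [Set.union_comm, hC], hv, hu, hcard.symm,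
          (joinedTrees_symm _ _ _ _ _).subset hJ, h0⟩
    obtain ⟨hA, hB⟩ := crossesGaps_of_joinedTrees hu hv hJ
    obtain ⟨k, hk, rfl⟩ := region_of_balanced hAB hC hA hB hw hcard
    obtain rfl : B = region n n \ region k (n - k) := by
      rw [← hC, Set.union_sdiff_cancel_left hAB.le_bot]
    exact Set.mem_biUnion hk (mem_halvedTrees.2 ⟨u, v, ⟨hu, hv, hJ.1 hJ.2.2.1⟩, hJ⟩)
  · intro hH
    obtain ⟨k, hk, hH⟩ := Set.mem_iUnion₂.1 hH
    rw [Finset.mem_range] at hk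
    obtain ⟨u, v, huv, hJ⟩ := mem_halvedTrees.1 hH
    exact ⟨_, _, u, v, Set.disjoint_sdiff_right, Set.union_sdiff_cancel (region_subset_region hk.le),
      huv.1, huv.2.1, ncard_region_sdiff hk.le, hJ⟩

/-- The number of balanced spanning trees of the grid. -/
theorem S_succ (n : ℕ) : S (n + 1) = n + 1 + ∑ k ∈ Finset.range n,
    (max (k + 1) (n - k) - min (k + 1) (n - k) + 2) * T (min (k + 1) (n - k)) ^ 2 := by
  rw [S_eq_ncard, balancedTreesOn_region, ncard_biUnion_finset]
  -- The term k = 0 is split off: there are n + 1 rungs between the two rows, each row carrying a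
  -- single tree.
  · rw [Finset.sum_range_succ', add_comm, ncard_halvedTrees (by omega),
      ncard_cutEdges_zero (by omega), regionTrees_symm, regionTrees_zero_right (by omega)]
    congr 1
    · ring
    · refine Finset.sum_congr rfl fun k hk => ?_
      rw [Finset.mem_range] at hk
      rw [ncard_halvedTrees (by omega), ncard_cutEdges (by omega) (by omega),
        show n + 1 - (k + 1) = n - k by omega]
      rcases le_total (k + 1) (n - k) with h | h
      · rw [regionTrees_of_ge (by omega) h, min_eq_left h]
      · rw [regionTrees_of_le (by omega) h, min_eq_right h]
  · intro k hk
    rw [Finset.mem_range] at hk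
    exact (finite_treesOn ladder (finite_region _ _)).subset (halvedTrees_subset hk.le)
  · intro k hk k' hk' hne
    rw [Finset.mem_range] at hk hk'
    rw [Set.disjoint_left]
    intro H hH hH'
    obtain ⟨u, v, huv, hJ⟩ := mem_halvedTrees.1 hH
    obtain ⟨u', v', -, hJ'⟩ := mem_halvedTrees.1 hH'
    exact hne (cut_unique hk hk' huv hJ hJ').1

/-- The summand is unchanged when the two row lengths are exchanged, so the upper half of the range,
reversed, repeats the lower half. -/
theorem S_odd_eq_sum (m : ℕ) : S (2 * m + 1) = 2 * m + 1 +
    2 * ∑ k ∈ Finset.range m, (2 * (m - 1 - k) + 3) * T (k + 1) ^ 2 := by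
  rw [S_succ, two_mul m, Finset.sum_range_add, two_mul (Finset.sum _ _)]
  congr 2
  · refine Finset.sum_congr rfl fun k hk => ?_
    rw [Finset.mem_range] at hk
    rw [min_eq_left (by omega), max_eq_right (by omega)]
    congr 1
    omega
  · rw [← Finset.sum_range_reflect]
    refine Finset.sum_congr rfl fun k hk => ?_
    rw [Finset.mem_range] at hk
    rw [min_eq_right (by omega), max_eq_left (by omega),
      show m + m - (m + (m - 1 - k)) = k + 1 by omega]
    congr 1
    omega

/-- The same folding now leaves a middle term, where both row lengths are m + 1 and only the two
horizontal edges cross. -/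
theorem S_even_eq_sum (m : ℕ) : S (2 * (m + 1)) = 2 * (m + 1) + 2 * T (m + 1) ^ 2 +
    2 * ∑ k ∈ Finset.range m, (2 * (m - 1 - k) + 4) * T (k + 1) ^ 2 := by
  rw [show 2 * (m + 1) = (m + 1 + m) + 1 by ring, S_succ, Finset.sum_range_add,
    Finset.sum_range_succ, two_mul (Finset.sum _ _)]
  have h1 : ∑ k ∈ Finset.range m, (max (k + 1) (m + 1 + m - k) - min (k + 1) (m + 1 + m - k) + 2) *
      T (min (k + 1) (m + 1 + m - k)) ^ 2 =
      ∑ k ∈ Finset.range m, (2 * (m - 1 - k) + 4) * T (k + 1) ^ 2 := by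
    refine Finset.sum_congr rfl fun k hk => ?_
    rw [Finset.mem_range] at hk
    rw [min_eq_left (by omega), max_eq_right (by omega)]
    congr 1
    omega
  have h2 : ∑ k ∈ Finset.range m, (max (m + 1 + k + 1) (m + 1 + m - (m + 1 + k)) -
      min (m + 1 + k + 1) (m + 1 + m - (m + 1 + k)) + 2) *
      T (min (m + 1 + k + 1) (m + 1 + m - (m + 1 + k))) ^ 2 =
      ∑ k ∈ Finset.range m, (2 * (m - 1 - k) + 4) * T (k + 1) ^ 2 := by
    rw [← Finset.sum_range_reflect]
    refine Finset.sum_congr rfl fun k hk => ?_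
    rw [Finset.mem_range] at hk
    rw [min_eq_right (by omega), max_eq_left (by omega),
      show m + 1 + m - (m + 1 + (m - 1 - k)) = k + 1 by omega]
    congr 1
    omega
  rw [h1, h2, show m + 1 + m - m = m + 1 by omega, max_self, min_self]
  simp
  ring

/-! ### Closed forms for both counts -/

theorem T_closed_form (n : ℕ) :
    (T n : ℝ) = ((2 + √3) ^ n - (2 - √3) ^ n) / (2 * √3) := by
  have h3 : √3 ^ 2 = (3 : ℝ) := Real.sq_sqrt (by norm_num)
  have hpos : 0 < √(3 : ℝ) := by positivity
  induction n using Nat.twoStepInduction with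
  | zero => simp [T_zero]
  | one => rw [T_one]; field_simp; push_cast; ring
  | more n ih1 ih2 =>
    have h := congrArg (Nat.cast (R := ℝ)) (T_add_two n)
    push_cast at h
    rw [← eq_sub_iff_add_eq] at h
    rw [h, ih1, ih2]
    field_simp
    ring_nf
    rw [h3]
    ring

theorem conj_pow_mul_pow (n : ℕ) : (2 + √3) ^ n * (2 - √3) ^ n = (1 : ℝ) := by
  have h3 : √3 ^ 2 = (3 : ℝ) := Real.sq_sqrt (by norm_num)
  rw [← mul_pow, show (2 + √3) * (2 - √3) = (1 : ℝ) by ring_nf; rw [h3]; norm_num, one_pow]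

/-- A case of T(a)² - T(b)² = T(a - b) T(a + b), the analogue of the identity for sinh, with T(1) =
1. -/
theorem T_succ_sq (m : ℕ) : T (m + 1) ^ 2 = T m ^ 2 + T (2 * m + 1) := by
  have h3 : √3 ^ 2 = (3 : ℝ) := Real.sq_sqrt (by norm_num)
  have hpos : 0 < √(3 : ℝ) := by positivity
  have hxy := conj_pow_mul_pow m
  have h : (T (m + 1) : ℝ) ^ 2 = T m ^ 2 + T (2 * m + 1) := by
    rw [T_closed_form, T_closed_form, T_closed_form]
    simp only [pow_succ, pow_mul', pow_zero, one_mul]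
    generalize (2 + √3) ^ m = x at *
    generalize (2 - √3) ^ m = y at *
    field_simp
    linear_combination -(x - y) ^ 2 * h3
  exact_mod_cast h

/-- With α, β = 2 ± √3, both 12 T(m+1)² + 2 and T(2m+3) - T(2m+1) equal α^(2m+2) + β^(2m+2). This
makes the sum of squares telescope. -/
theorem twelve_mul_T_succ_sq (m : ℕ) : 12 * T (m + 1) ^ 2 + T (2 * m + 1) + 2 = T (2 * m + 3) := by
  have h3 : √3 ^ 2 = (3 : ℝ) := Real.sq_sqrt (by norm_num)
  have hpos : 0 < √(3 : ℝ) := by positivity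
  have hxy := conj_pow_mul_pow m
  have h : 12 * (T (m + 1) : ℝ) ^ 2 + T (2 * m + 1) + 2 = T (2 * m + 3) := by
    rw [T_closed_form, T_closed_form, T_closed_form]
    simp only [pow_succ, pow_mul', pow_zero, one_mul]
    generalize (2 + √3) ^ m = x at *
    generalize (2 - √3) ^ m = y at *
    field_simp
    linear_combination (24 * x * y + 8 - (2 * √3 ^ 2 + 12 * √3 + 16) * x ^ 2 -
      (2 * √3 ^ 2 - 12 * √3 + 16) * y ^ 2) * h3 - 24 * hxy
  exact_mod_cast h

theorem sum_T_sq (m : ℕ) : 12 * ∑ k ∈ Finset.range m, T (k + 1) ^ 2 + (2 * m + 1) = T (2 * m + 1) := by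
  induction m with
  | zero => simp [T_one]
  | succ m ih =>
    rw [Finset.sum_range_succ]
    have := twelve_mul_T_succ_sq m
    rw [show 2 * (m + 1) + 1 = 2 * m + 3 by ring]
    omega

/-- Passing from m to m + 1 raises each weight by one and so adds the plain sum of squares. By
`sum_T_sq` and `T_succ_sq` the right side grows accordingly. The truncated subtraction is exact,
since k < m. -/
theorem sum_mul_T_sq (m : ℕ) :
    12 * ∑ k ∈ Finset.range m, (m - 1 - k) * T (k + 1) ^ 2 + m ^ 2 = T m ^ 2 := by
  induction m with
  | zero => simp [T_zero]
  | succ m ih =>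
    have h : ∑ k ∈ Finset.range (m + 1), (m + 1 - 1 - k) * T (k + 1) ^ 2 =
        ∑ k ∈ Finset.range m, (m - 1 - k) * T (k + 1) ^ 2 + ∑ k ∈ Finset.range m, T (k + 1) ^ 2 := by
      rw [Finset.sum_range_succ, ← Finset.sum_add_distrib]
      simp only [add_tsub_cancel_right, tsub_self, zero_mul, add_zero]
      refine Finset.sum_congr rfl fun k hk => ?_
      rw [Finset.mem_range] at hk
      rw [show m - k = m - 1 - k + 1 by omega]
      ring
    have := sum_T_sq m
    rw [h, T_succ_sq, ← ih, ← this]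
    ring

theorem S_odd (m : ℕ) : (S (2 * m + 1) : ℝ) = T (2 * m + 1) / 2 + T m ^ 2 / 3 +
    (-1 / 12 * ((2 * m + 1 : ℕ) : ℝ) ^ 2 + 2 / 3 * (2 * m + 1 : ℕ) - 1 / 12) := by
  have h : S (2 * m + 1) = 2 * m + 1 + (4 * ∑ k ∈ Finset.range m, (m - 1 - k) * T (k + 1) ^ 2 +
      6 * ∑ k ∈ Finset.range m, T (k + 1) ^ 2) := by
    rw [S_odd_eq_sum, Finset.mul_sum, Finset.mul_sum, Finset.mul_sum, ← Finset.sum_add_distrib]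
    congr 1
    exact Finset.sum_congr rfl fun k _ => by ring
  have h1 := congrArg (Nat.cast (R := ℝ)) (sum_T_sq m)
  have h2 := congrArg (Nat.cast (R := ℝ)) (sum_mul_T_sq m)
  rw [h]
  push_cast [-Nat.cast_sum] at h1 h2 ⊢
  linear_combination h1 / 2 + h2 / 3

theorem S_even (m : ℕ) : (S (2 * (m + 1)) : ℝ) = 2 * T (m + 1) ^ 2 + T m ^ 2 / 3 +
    2 / 3 * T (2 * m + 1) +
    (-1 / 12 * ((2 * (m + 1) : ℕ) : ℝ) ^ 2 + 2 / 3 * (2 * (m + 1) : ℕ) + 1 / 3) := by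
  have h : S (2 * (m + 1)) = 2 * (m + 1) + 2 * T (m + 1) ^ 2 +
      (4 * ∑ k ∈ Finset.range m, (m - 1 - k) * T (k + 1) ^ 2 +
      8 * ∑ k ∈ Finset.range m, T (k + 1) ^ 2) := by
    rw [S_even_eq_sum, Finset.mul_sum, Finset.mul_sum, Finset.mul_sum, ← Finset.sum_add_distrib]
    congr 1
    exact Finset.sum_congr rfl fun k _ => by ring
  have h1 := congrArg (Nat.cast (R := ℝ)) (sum_T_sq m)
  have h2 := congrArg (Nat.cast (R := ℝ)) (sum_mul_T_sq m)
  rw [h]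
  push_cast [-Nat.cast_sum] at h1 h2 ⊢
  linear_combination 2 / 3 * h1 + h2 / 3

/-! ### Asymptotics and the two limits -/

theorem tendsto_T_div_pow :
    Tendsto (fun n : ℕ => (T n : ℝ) / (2 + √3) ^ n) atTop (𝓝 (1 / (2 * √3))) := by
  have h3 : √3 ^ 2 = (3 : ℝ) := Real.sq_sqrt (by norm_num)
  have hpos : 0 < √(3 : ℝ) := by positivity
  have h1 : 1 < √(3 : ℝ) := by nlinarith
  have h2 : √(3 : ℝ) < 2 := by nlinarith
  have h : Tendsto (fun n : ℕ => (1 - ((2 - √3) / (2 + √3)) ^ n) / (2 * √3)) atTop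
      (𝓝 ((1 - 0) / (2 * √3))) := by
    refine ((tendsto_pow_atTop_nhds_zero_of_lt_one ?_ ?_).const_sub 1).div_const _
    · exact div_nonneg (by linarith) (by linarith)
    · rw [div_lt_one (by linarith)]; linarith
  rw [sub_zero] at h
  refine h.congr fun n => ?_
  rw [T_closed_form, div_pow]
  field_simp

theorem tendsto_quadratic_div_T (a b c : ℝ) :
    Tendsto (fun n : ℕ => (a * (n : ℝ) ^ 2 + b * n + c) / T n) atTop (𝓝 0) := by
  have hpos : 0 < √(3 : ℝ) := by positivity
  have hα : 1 < 2 + √(3 : ℝ) := by linarith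
  have h0 := tendsto_pow_const_div_const_pow_of_one_lt 0 hα
  have h1 := tendsto_pow_const_div_const_pow_of_one_lt 1 hα
  have h2 := tendsto_pow_const_div_const_pow_of_one_lt 2 hα
  have h := (((h2.const_mul a).add (h1.const_mul b)).add (h0.const_mul c)).div tendsto_T_div_pow
    (by positivity)
  simp only [mul_zero, add_zero, zero_div] at h
  refine h.congr fun n => ?_
  have : (2 + √(3 : ℝ)) ^ n ≠ 0 := by positivity
  simp only [Pi.div_apply]
  rw [← mul_div_assoc, ← mul_div_assoc, ← mul_div_assoc, ← add_div, ← add_div,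
    div_div_div_cancel_right₀ this, pow_one, pow_zero, mul_one]

theorem tendsto_odd_ratio : Tendsto (fun m : ℕ => (S (2 * m + 1) : ℝ) / (T (2 * m + 1) : ℝ)) atTop
    (𝓝 ((3 + √3) / 9)) := by
  have h3 : √3 ^ 2 = (3 : ℝ) := Real.sq_sqrt (by norm_num)
  have hpos : 0 < √(3 : ℝ) := by positivity
  have hN : Tendsto (fun m : ℕ => 2 * m + 1) atTop atTop :=
    tendsto_atTop_mono (fun m => by simp only [id]; omega) tendsto_id
  have hT := tendsto_T_div_pow
  have hTN := hT.comp hN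
  have hq := (tendsto_quadratic_div_T (-1 / 12) (2 / 3) (-1 / 12)).comp hN
  have hc : (1 : ℝ) / (2 * √3) ≠ 0 := by positivity
  -- Normalizing T(m)² by α^(2m) and T(2m+1) by α^(2m+1), with α = 2 + √3, leaves a factor 1/α,
  -- which joins the coefficient 1/3 from `S_odd`.
  have h1 := (((hT.pow 2).div hTN hc).div_const (3 * (2 + √3))).const_add (1 / 2)
  have h := h1.add hq
  have hlim : (1 : ℝ) / 2 + (1 / (2 * √3)) ^ 2 / (1 / (2 * √3)) / (3 * (2 + √3)) + 0 =
      (3 + √3) / 9 := by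
    field_simp
    ring_nf
    nlinarith
  rw [hlim] at h
  refine h.congr' ?_
  filter_upwards [hTN.eventually_ne hc] with m hm
  have hTne : (T (2 * m + 1) : ℝ) ≠ 0 := by
    intro h0
    simp [h0] at hm
  rw [S_odd]
  simp only [Function.comp_apply, Pi.div_apply]
  have hα : (2 + √(3 : ℝ)) ≠ 0 := by positivity
  field_simp
  ring

theorem tendsto_even_ratio : Tendsto (fun m : ℕ => (S (2 * m) : ℝ) / (T (2 * m) : ℝ)) atTop
    (𝓝 ((1 + 4 * √3) / (6 * √3))) := by
  -- The shift matches the index 2(m + 1) of `S_even` and drops the term with T 0 = 0 in the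
  -- denominator.
  rw [← tendsto_add_atTop_iff_nat 1]
  have h3 : √3 ^ 2 = (3 : ℝ) := Real.sq_sqrt (by norm_num)
  have hpos : 0 < √(3 : ℝ) := by positivity
  have hN : Tendsto (fun m : ℕ => 2 * (m + 1)) atTop atTop :=
    tendsto_atTop_mono (fun m => by simp only [id]; omega) tendsto_id
  have hN' : Tendsto (fun m : ℕ => 2 * m + 1) atTop atTop :=
    tendsto_atTop_mono (fun m => by simp only [id]; omega) tendsto_id
  have hT := tendsto_T_div_pow
  have hT1 := hT.comp (tendsto_add_atTop_nat 1)
  have hTN := hT.comp hN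
  have hTN' := hT.comp hN'
  have hq := (tendsto_quadratic_div_T (-1 / 12) (2 / 3) (1 / 3)).comp hN
  have hc : (1 : ℝ) / (2 * √3) ≠ 0 := by positivity
  -- Relative to α^(2m+2), the terms T(m+1)², T(m)² and T(2m+1) of `S_even` leave the factors 1, α⁻²
  -- and α⁻¹.
  have h := (((((hT1.pow 2).div hTN hc).const_mul 2).add
    (((hT.pow 2).div hTN hc).div_const (3 * (2 + √3) ^ 2))).add
    ((hTN'.div hTN hc).const_mul (2 / (3 * (2 + √3))))).add hq
  have hlim : (2 : ℝ) * ((1 / (2 * √3)) ^ 2 / (1 / (2 * √3))) +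
      (1 / (2 * √3)) ^ 2 / (1 / (2 * √3)) / (3 * (2 + √3) ^ 2) +
      2 / (3 * (2 + √3)) * ((1 / (2 * √3)) / (1 / (2 * √3))) + 0 =
      (1 + 4 * √3) / (6 * √3) := by
    have h4 : √3 ^ 3 = 3 * √(3 : ℝ) := by rw [pow_succ, h3]
    field_simp
    ring_nf
    rw [h3]
    try rw [h4]
    ring
  rw [hlim] at h
  refine h.congr' ?_
  filter_upwards [hTN.eventually_ne hc] with m hm
  have hTne : (T (2 * (m + 1)) : ℝ) ≠ 0 := by
    intro h0
    simp [h0] at hm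
  rw [S_even]
  simp only [Function.comp_apply, Pi.div_apply]
  have hα : (2 + √(3 : ℝ)) ≠ 0 := by positivity
  field_simp
  ring

end BalancedTrees

theorem theorem1 :
    (Filter.Tendsto
        (fun m : ℕ => (BalancedTrees.S (2 * m + 1) : ℝ) / (BalancedTrees.T (2 * m + 1) : ℝ))
        Filter.atTop (nhds ((3 + Real.sqrt 3) / 9)) ∧
      |(3 + Real.sqrt 3) / 9 - 0.53| < 0.005) ∧
    (Filter.Tendsto
        (fun m : ℕ => (BalancedTrees.S (2 * m) : ℝ) / (BalancedTrees.T (2 * m) : ℝ))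
        Filter.atTop (nhds ((1 + 4 * Real.sqrt 3) / (6 * Real.sqrt 3))) ∧
      |(1 + 4 * Real.sqrt 3) / (6 * Real.sqrt 3) - 0.76| < 0.005) := by
  have h1 : (1.73 : ℝ) < √3 := by rw [Real.lt_sqrt (by norm_num)]; norm_num
  have h2 : √3 < (1.74 : ℝ) := by rw [Real.sqrt_lt' (by norm_num)]; norm_num
  refine ⟨⟨BalancedTrees.tendsto_odd_ratio, ?_⟩, BalancedTrees.tendsto_even_ratio, ?_⟩
  · rw [abs_lt]
    constructor <;> linarith
  · rw [abs_sub_lt_iff, sub_lt_iff_lt_add, sub_lt_comm, div_lt_iff₀ (by positivity),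
      lt_div_iff₀ (by positivity)]
    constructor <;> linarith
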